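/- **Theorem.** Let $m,n,p\in\mathbb N$. A linear system of type $(m,n,p)$ is a triple $(A,B,C)\in M_n(\mathbb C)\times M_{n\times m}(\mathbb C)\times M_{p\times n}(\mathbb C)$; it is *completely observable* if the matrix with block rows $C, CA,\dots,CA^{n-1}$ has rank $n$. Let $\mathrm{sys}^{co}_{m,n,p}$ be the moduli space of completely observable systems, that is, the orbit space of these systems under $g\cdot(A,B,C)=(gAg^{-1},gB,Cg^{-1})$, $g\in GL_n(\mathbb C)$, with its quotient structure of an algebraic variety (Zariski quotient topology; regular functions are the functions that pull back to regular functions). Let $\mathrm{Gras}_n(p+n-1)$ be the Grassmannian of $n$-dimensional subspaces of $\mathbb C^{p+n-1}$ (for $p=n=0$ read $p+n-1$ as $0$). For $I\subset\{1,\dots,p+n-1\}$ with $|I|=n$ let $S_I$ be the Schubert cell of the row spaces of those $n\times(p+n-1)$ matrices of rank $n$ whose first $k$ columns span a space of dimension $|I\cap\{1,\dots,k\}|$ for every $k$, and put $d_I=|\{(i,j): i\in I,\ j\notin I,\ i<j\}|$. A *cell decomposition* of a variety is a finite partition into locally closed subsets (cells), each isomorphic to an affine space, such that the closure of every cell is the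 union of that cell and of cells of strictly smaller dimension. Then the moduli space $\mathrm{sys}^{co}_{m,n,p}$ has a cell decomposition identical to the natural cell decomposition of a vector bundle of rank $n(m+1)$ over $\mathrm{Gras}_n(p+n-1)$ with respect to the Schubert cells. Precisely: there are an algebraic vector bundle $\pi:E\to\mathrm{Gras}_n(p+n-1)$ of rank $n(m+1)$ and subsets $X_I\subset\mathrm{sys}^{co}_{m,n,p}$, indexed by the $n$-element subsets $I$ of $\{1,\dots,p+n-1\}$, such that 1. the sets $\pi^{-1}(S_I)$ form a cell decomposition of $E$, with $\pi^{-1}(S_I)\cong\mathbb A^{d_I+n(m+1)}$; 2. the sets $X_I$ form a cell decomposition of $\mathrm{sys}^{co}_{m,n,p}$, with $X_I\cong\mathbb A^{d_I+n(m+1)}$; 3. for all $I,J$: $X_J\subset\overline{X_I}$ if and only if $\pi^{-1}(S_J)\subset\overline{\pi^{-1}(S_I)}$. -/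

import Mathlib

open Topology

noncomputable section

namespace ObsSys

/-! ### Spaces with functions (complex algebraic prevarieties in the sense of Serre) -/

/-- A space with functions over `ℂ`: a topological space together with the notion of a
complex valued function being regular at a point. The notion is local, stable under the ring
operations, and a regular function which does not vanish at a point does not vanish near it and
has a regular inverse there. A function is regular on an open set when it is regular at each
point of it (values off the open set are irrelevant). -/
structure FunSpace (X : Type) extends TopologicalSpace X where
  RegularAt : (X → ℂ) → X → Prop
  regularAt_congr : ∀ (f g : X → ℂ) (x : X) (U : Set X), IsOpen U → x ∈ U →
    (∀ y ∈ U, f y = g y) → RegularAt f x → RegularAt g x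
  regularAt_open : ∀ (f : X → ℂ) (x : X), RegularAt f x →
    ∃ U : Set X, IsOpen U ∧ x ∈ U ∧ ∀ y ∈ U, RegularAt f y
  regularAt_const : ∀ (c : ℂ) (x : X), RegularAt (fun _ => c) x
  regularAt_add : ∀ (f g : X → ℂ) (x : X), RegularAt f x → RegularAt g x →
    RegularAt (fun y => f y + g y) x
  regularAt_mul : ∀ (f g : X → ℂ) (x : X), RegularAt f x → RegularAt g x →
    RegularAt (fun y => f y * g y) x
  regularAt_inv : ∀ (f : X → ℂ) (x : X), RegularAt f x → f x ≠ 0 →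
    (∃ U : Set X, IsOpen U ∧ x ∈ U ∧ ∀ y ∈ U, f y ≠ 0) ∧ RegularAt (fun y => (f y)⁻¹) x

namespace FunSpace

variable {X Y : Type}

/-- Morphisms: continuous maps that pull regular functions back to regular functions. -/
def IsMorphism (S : FunSpace X) (T : FunSpace Y) (φ : X → Y) : Prop :=
  Continuous[S.toTopologicalSpace, T.toTopologicalSpace] φ ∧
    ∀ (f : Y → ℂ) (x : X), T.RegularAt f (φ x) → S.RegularAt (f ∘ φ) x

/-- Isomorphisms: bijections that are morphisms in both directions. -/
def IsIso (S : FunSpace X) (T : FunSpace Y) (φ : X → Y) : Prop :=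
  ∃ e : X ≃ Y, ⇑e = φ ∧ IsMorphism S T e ∧ IsMorphism T S e.symm

/-- Two spaces with functions are isomorphic. -/
def Isomorphic (S : FunSpace X) (T : FunSpace Y) : Prop :=
  ∃ φ : X → Y, IsIso S T φ

/-- The structure induced along a map `j : X → Y`. For the inclusion of a subset this is the
subspace topology together with the functions that locally extend to regular functions of the
ambient space. -/
def induced (T : FunSpace Y) (j : X → Y) : FunSpace X where
  toTopologicalSpace := TopologicalSpace.induced j T.toTopologicalSpace
  RegularAt f x := ∃ (F : Y → ℂ) (U : Set Y), T.RegularAt F (j x) ∧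
    IsOpen[T.toTopologicalSpace] U ∧ j x ∈ U ∧ ∀ y : X, j y ∈ U → f y = F (j y)
  regularAt_congr := by
    let _ := T.toTopologicalSpace
    rintro f g x _ ⟨U', hU', rfl⟩ hx hfg ⟨F, V, hF, hV, hxV, h⟩
    exact ⟨F, U' ∩ V, hF, hU'.inter hV, ⟨hx, hxV⟩, fun y hy => (hfg y hy.1) ▸ h y hy.2⟩
  regularAt_open := by
    let _ := T.toTopologicalSpace
    rintro f x ⟨F, V, hF, hV, hxV, h⟩
    obtain ⟨W, hW, hxW, hr⟩ := T.regularAt_open F _ hF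
    exact ⟨j ⁻¹' (V ∩ W), ⟨V ∩ W, hV.inter hW, rfl⟩, ⟨hxV, hxW⟩,
      fun y hy => ⟨F, V, hr _ hy.2, hV, hy.1, h⟩⟩
  regularAt_const := by
    let _ := T.toTopologicalSpace
    exact fun c x => ⟨fun _ => c, Set.univ, T.regularAt_const c _, isOpen_univ, trivial,
      fun _ _ => rfl⟩
  regularAt_add := by
    let _ := T.toTopologicalSpace
    rintro f g x ⟨F, V, hF, hV, hxV, h⟩ ⟨G, W, hG, hW, hxW, h2⟩
    exact ⟨_, V ∩ W, T.regularAt_add F G _ hF hG, hV.inter hW, ⟨hxV, hxW⟩,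
      fun y hy => by simp only [h y hy.1, h2 y hy.2]⟩
  regularAt_mul := by
    let _ := T.toTopologicalSpace
    rintro f g x ⟨F, V, hF, hV, hxV, h⟩ ⟨G, W, hG, hW, hxW, h2⟩
    exact ⟨_, V ∩ W, T.regularAt_mul F G _ hF hG, hV.inter hW, ⟨hxV, hxW⟩,
      fun y hy => by simp only [h y hy.1, h2 y hy.2]⟩
  regularAt_inv := by
    let _ := T.toTopologicalSpace
    rintro f x ⟨F, V, hF, hV, hxV, h⟩ hx
    obtain ⟨⟨W, hW, hxW, hne⟩, hinv⟩ := T.regularAt_inv F _ hF (h x hxV ▸ hx)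
    refine ⟨⟨j ⁻¹' (V ∩ W), ⟨V ∩ W, hV.inter hW, rfl⟩, ⟨hxV, hxW⟩, fun y hy => ?_⟩,
      _, V, hinv, hV, hxV, fun y hy => by simp only [h y hy]⟩
    rw [h y hy.1]
    exact hne _ hy.2

/-- The structure of a subset. -/
abbrev restrict (T : FunSpace Y) (s : Set Y) : FunSpace s :=
  T.induced (Subtype.val : s → Y)

/-- The quotient structure along a (surjective) map `q : X → Y`: the quotient topology, and a
function is regular at `y` when its pull-back is regular over a neighbourhood of `y`. -/
def quotient (S : FunSpace X) (q : X → Y) : FunSpace Y where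
  toTopologicalSpace := TopologicalSpace.coinduced q S.toTopologicalSpace
  RegularAt f y := ∃ V : Set Y, IsOpen[S.toTopologicalSpace] (q ⁻¹' V) ∧ y ∈ V ∧
    ∀ x : X, q x ∈ V → S.RegularAt (f ∘ q) x
  regularAt_congr := by
    let _ := S.toTopologicalSpace
    rintro f g y U hU hy hfg ⟨V, hV, hyV, h⟩
    have hU' : IsOpen (q ⁻¹' U) := hU
    exact ⟨U ∩ V, hU'.inter hV, ⟨hy, hyV⟩, fun x hx =>
      S.regularAt_congr (f ∘ q) (g ∘ q) x _ hU' hx.1 (fun z hz => hfg _ hz) (h x hx.2)⟩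
  regularAt_open := by
    rintro f y ⟨V, hV, hyV, h⟩
    exact ⟨V, hV, hyV, fun z hz => ⟨V, hV, hz, h⟩⟩
  regularAt_const := by
    let _ := S.toTopologicalSpace
    exact fun c y => ⟨Set.univ, isOpen_univ, trivial, fun x _ => S.regularAt_const c x⟩
  regularAt_add := by
    let _ := S.toTopologicalSpace
    rintro f g y ⟨V, hV, hyV, h⟩ ⟨W, hW, hyW, h2⟩
    exact ⟨V ∩ W, hV.inter hW, ⟨hyV, hyW⟩,
      fun x hx => S.regularAt_add _ _ x (h x hx.1) (h2 x hx.2)⟩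
  regularAt_mul := by
    let _ := S.toTopologicalSpace
    rintro f g y ⟨V, hV, hyV, h⟩ ⟨W, hW, hyW, h2⟩
    exact ⟨V ∩ W, hV.inter hW, ⟨hyV, hyW⟩,
      fun x hx => S.regularAt_mul _ _ x (h x hx.1) (h2 x hx.2)⟩
  regularAt_inv := by
    let _ := S.toTopologicalSpace
    rintro f y ⟨V, hV, hyV, h⟩ hy
    have hO : IsOpen (q ⁻¹' {z | z ∈ V ∧ f z ≠ 0}) := by
      refine isOpen_iff_forall_mem_open.2 fun x hx => ?_
      obtain ⟨⟨W, hW, hxW, hne⟩, -⟩ := S.regularAt_inv _ x (h x hx.1) hx.2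
      exact ⟨q ⁻¹' V ∩ W, fun z hz => ⟨hz.1, hne z hz.2⟩, hV.inter hW, hx.1, hxW⟩
    exact ⟨⟨{z | z ∈ V ∧ f z ≠ 0}, hO, ⟨hyV, hy⟩, fun z hz => hz.2⟩,
      {z | z ∈ V ∧ f z ≠ 0}, hO, ⟨hyV, hy⟩,
      fun x hx => (S.regularAt_inv _ x (h x hx.1) hx.2).2⟩

/-- Affine space `𝔸^σ`: the open sets of the Zariski topology are the unions of sets `Q ≠ 0`, and
regular functions are locally quotients of polynomials. -/
def affine (σ : Type) : FunSpace (σ → ℂ) where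
  IsOpen U := ∀ x ∈ U, ∃ Q : MvPolynomial σ ℂ, Q.eval x ≠ 0 ∧ ∀ y, Q.eval y ≠ 0 → y ∈ U
  isOpen_univ := fun _ _ => ⟨1, by simp, fun _ _ => trivial⟩
  isOpen_inter := by
    rintro U V hU hV x ⟨hxU, hxV⟩
    obtain ⟨P, hP, hPU⟩ := hU x hxU
    obtain ⟨Q, hQ, hQV⟩ := hV x hxV
    refine ⟨P * Q, by simp [hP, hQ], fun y hy => ?_⟩
    simp only [map_mul, ne_eq, mul_eq_zero, not_or] at hy
    exact ⟨hPU y hy.1, hQV y hy.2⟩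
  isOpen_sUnion := by
    rintro C hC x ⟨U, hU, hx⟩
    obtain ⟨Q, hQ, hQU⟩ := hC U hU x hx
    exact ⟨Q, hQ, fun y hy => ⟨U, hU, hQU y hy⟩⟩
  RegularAt f x := ∃ P Q : MvPolynomial σ ℂ, Q.eval x ≠ 0 ∧
    ∀ y, Q.eval y ≠ 0 → f y = P.eval y / Q.eval y
  regularAt_congr := by
    rintro f g x U hU hx hfg ⟨P, Q, hQ, h⟩
    obtain ⟨R, hR, hRU⟩ := hU x hx
    refine ⟨P * R, Q * R, by simp [hQ, hR], fun y hy => ?_⟩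
    simp only [map_mul, ne_eq, mul_eq_zero, not_or] at hy
    rw [← hfg y (hRU y hy.2), h y hy.1, map_mul, map_mul, mul_div_mul_right _ _ hy.2]
  regularAt_open := by
    rintro f x ⟨P, Q, hQ, h⟩
    exact ⟨{y | Q.eval y ≠ 0}, fun y hy => ⟨Q, hy, fun _ hz => hz⟩, hQ,
      fun y hy => ⟨P, Q, hy, h⟩⟩
  regularAt_const := fun c x => ⟨MvPolynomial.C c, 1, by simp, by simp⟩
  regularAt_add := by
    rintro f g x ⟨P, Q, hQ, h⟩ ⟨P', Q', hQ', h'⟩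
    refine ⟨P * Q' + Q * P', Q * Q', by simp [hQ, hQ'], fun y hy => ?_⟩
    simp only [map_mul, ne_eq, mul_eq_zero, not_or] at hy
    beta_reduce
    rw [h y hy.1, h' y hy.2, div_add_div _ _ hy.1 hy.2]
    simp
  regularAt_mul := by
    rintro f g x ⟨P, Q, hQ, h⟩ ⟨P', Q', hQ', h'⟩
    refine ⟨P * P', Q * Q', by simp [hQ, hQ'], fun y hy => ?_⟩
    simp only [map_mul, ne_eq, mul_eq_zero, not_or] at hy
    beta_reduce
    rw [h y hy.1, h' y hy.2, div_mul_div_comm]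
    simp
  regularAt_inv := by
    rintro f x ⟨P, Q, hQ, h⟩ hx
    have hP : P.eval x ≠ 0 := fun h0 => hx (by rw [h x hQ, h0, zero_div])
    refine ⟨⟨{y | (P * Q).eval y ≠ 0}, fun y hy => ⟨_, hy, fun _ hz => hz⟩, by simp [hP, hQ],
      fun y hy => ?_⟩, Q * Q, P * Q, by simp [hP, hQ], fun y hy => ?_⟩
    · simp only [Set.mem_ofPred_eq, map_mul, ne_eq, mul_eq_zero, not_or] at hy
      rw [h y hy.2]
      exact div_ne_zero hy.1 hy.2
    · simp only [map_mul, ne_eq, mul_eq_zero, not_or] at hy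
      beta_reduce
      rw [h y hy.2, inv_div, map_mul, map_mul, mul_div_mul_right _ _ hy.2]

/-- The value at `(y, w)` of a polynomial with coefficients in the functions on `X`. -/
def evalAt {σ : Type} (Q : MvPolynomial σ (X → ℂ)) (z : X × (σ → ℂ)) : ℂ :=
  MvPolynomial.eval z.2 (MvPolynomial.map (Pi.evalRingHom (fun _ : X => ℂ) z.1) Q)

/-- All coefficients of `Q` are regular on `U`. -/
def RegularCoeffs (S : FunSpace X) {σ : Type} (U : Set X) (Q : MvPolynomial σ (X → ℂ)) : Prop :=
  ∀ k : σ →₀ ℕ, ∀ y ∈ U, S.RegularAt (Q.coeff k) y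

section evalAt

variable {σ : Type}

theorem evalAt_mul (P Q : MvPolynomial σ (X → ℂ)) (z : X × (σ → ℂ)) :
    evalAt (P * Q) z = evalAt P z * evalAt Q z := by simp [evalAt]

theorem evalAt_add (P Q : MvPolynomial σ (X → ℂ)) (z : X × (σ → ℂ)) :
    evalAt (P + Q) z = evalAt P z + evalAt Q z := by simp [evalAt]

theorem evalAt_C (c : ℂ) (z : X × (σ → ℂ)) :
    evalAt (MvPolynomial.C (fun _ : X => c)) z = c := by simp [evalAt]

theorem RegularCoeffs.mono {S : FunSpace X} {U V : Set X} {Q : MvPolynomial σ (X → ℂ)}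
    (h : RegularCoeffs S U Q) (hVU : V ⊆ U) : RegularCoeffs S V Q :=
  fun k y hy => h k y (hVU hy)

theorem RegularCoeffs.add {S : FunSpace X} {U : Set X} {P Q : MvPolynomial σ (X → ℂ)}
    (hP : RegularCoeffs S U P) (hQ : RegularCoeffs S U Q) : RegularCoeffs S U (P + Q) := by
  intro k y hy
  rw [MvPolynomial.coeff_add]
  exact S.regularAt_add _ _ y (hP k y hy) (hQ k y hy)

theorem RegularCoeffs.mul {S : FunSpace X} {U : Set X} {P Q : MvPolynomial σ (X → ℂ)}
    (hP : RegularCoeffs S U P) (hQ : RegularCoeffs S U Q) : RegularCoeffs S U (P * Q) := by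
  classical
  intro k y hy
  rw [MvPolynomial.coeff_mul]
  refine Finset.sum_induction _ (fun f => S.RegularAt f y)
    (fun f g => S.regularAt_add f g y) (S.regularAt_const 0 y) fun d _ => ?_
  exact S.regularAt_mul _ _ y (hP _ y hy) (hQ _ y hy)

theorem regularCoeffs_C (S : FunSpace X) (U : Set X) (c : ℂ) :
    RegularCoeffs S U (MvPolynomial.C (σ := σ) (fun _ : X => c)) := by
  classical
  intro k y _
  rw [MvPolynomial.coeff_C]
  split_ifs
  · exact S.regularAt_const c y
  · exact S.regularAt_const 0 y

end evalAt

/-- The product `X × 𝔸^σ`. Open sets are the unions of sets of the form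
`{(y, w) | y ∈ U, Q (y, w) ≠ 0}`, where `U` is open in `X` and `Q` is a polynomial in `w` whose
coefficients are regular functions on `U`; regular functions are locally quotients of such
polynomials. -/
def prodAffine (S : FunSpace X) (σ : Type) : FunSpace (X × (σ → ℂ)) where
  IsOpen W := ∀ z ∈ W, ∃ (U : Set X) (Q : MvPolynomial σ (X → ℂ)),
    IsOpen[S.toTopologicalSpace] U ∧ z.1 ∈ U ∧ RegularCoeffs S U Q ∧ evalAt Q z ≠ 0 ∧
      ∀ z', z'.1 ∈ U → evalAt Q z' ≠ 0 → z' ∈ W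
  isOpen_univ := by
    let _ := S.toTopologicalSpace
    exact fun z _ => ⟨Set.univ, MvPolynomial.C (fun _ => 1), isOpen_univ, trivial,
      regularCoeffs_C S _ 1, by simp [evalAt_C], fun _ _ _ => trivial⟩
  isOpen_inter := by
    let _ := S.toTopologicalSpace
    rintro W W' hW hW' z ⟨hz, hz'⟩
    obtain ⟨U, P, hU, hzU, hP, hPz, h⟩ := hW z hz
    obtain ⟨V, Q, hV, hzV, hQ, hQz, h'⟩ := hW' z hz'
    refine ⟨U ∩ V, P * Q, hU.inter hV, ⟨hzU, hzV⟩,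
      (hP.mono Set.inter_subset_left).mul (hQ.mono Set.inter_subset_right),
      by simp [evalAt_mul, hPz, hQz], fun y hy hne => ?_⟩
    simp only [evalAt_mul, ne_eq, mul_eq_zero, not_or] at hne
    exact ⟨h y hy.1 hne.1, h' y hy.2 hne.2⟩
  isOpen_sUnion := by
    rintro C hC z ⟨W, hW, hz⟩
    obtain ⟨U, P, hU, hzU, hP, hPz, h⟩ := hC W hW z hz
    exact ⟨U, P, hU, hzU, hP, hPz, fun y hy hne => ⟨W, hW, h y hy hne⟩⟩
  RegularAt f z := ∃ (U : Set X) (P Q : MvPolynomial σ (X → ℂ)),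
    IsOpen[S.toTopologicalSpace] U ∧ z.1 ∈ U ∧ RegularCoeffs S U P ∧ RegularCoeffs S U Q ∧
      evalAt Q z ≠ 0 ∧ ∀ z', z'.1 ∈ U → evalAt Q z' ≠ 0 → f z' = evalAt P z' / evalAt Q z'
  regularAt_congr := by
    let _ := S.toTopologicalSpace
    rintro f g z W hW hz hfg ⟨U, P, Q, hU, hzU, hP, hQ, hQz, h⟩
    obtain ⟨V, R, hV, hzV, hR, hRz, h'⟩ := hW z hz
    have l : U ∩ V ⊆ U := Set.inter_subset_left
    have r : U ∩ V ⊆ V := Set.inter_subset_right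
    refine ⟨U ∩ V, P * R, Q * R, hU.inter hV, ⟨hzU, hzV⟩, (hP.mono l).mul (hR.mono r),
      (hQ.mono l).mul (hR.mono r), by simp [evalAt_mul, hQz, hRz], fun y hy hne => ?_⟩
    simp only [evalAt_mul, ne_eq, mul_eq_zero, not_or] at hne
    rw [← hfg y (h' y hy.2 hne.2), h y hy.1 hne.1, evalAt_mul, evalAt_mul,
      mul_div_mul_right _ _ hne.2]
  regularAt_open := by
    rintro f z ⟨U, P, Q, hU, hzU, hP, hQ, hQz, h⟩
    exact ⟨{y | y.1 ∈ U ∧ evalAt Q y ≠ 0},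
      fun y hy => ⟨U, Q, hU, hy.1, hQ, hy.2, fun _ h1 h2 => ⟨h1, h2⟩⟩, ⟨hzU, hQz⟩,
      fun y hy => ⟨U, P, Q, hU, hy.1, hP, hQ, hy.2, h⟩⟩
  regularAt_const := by
    let _ := S.toTopologicalSpace
    exact fun c z => ⟨Set.univ, MvPolynomial.C (fun _ => c), MvPolynomial.C (fun _ => 1),
      isOpen_univ, trivial, regularCoeffs_C S _ c, regularCoeffs_C S _ 1, by simp [evalAt_C],
      by simp [evalAt_C]⟩
  regularAt_add := by
    let _ := S.toTopologicalSpace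
    rintro f g z ⟨U, P, Q, hU, hzU, hP, hQ, hQz, h⟩ ⟨V, P', Q', hV, hzV, hP', hQ', hQz', h'⟩
    have l : U ∩ V ⊆ U := Set.inter_subset_left
    have r : U ∩ V ⊆ V := Set.inter_subset_right
    refine ⟨U ∩ V, P * Q' + Q * P', Q * Q', hU.inter hV, ⟨hzU, hzV⟩,
      ((hP.mono l).mul (hQ'.mono r)).add ((hQ.mono l).mul (hP'.mono r)),
      (hQ.mono l).mul (hQ'.mono r), by simp [evalAt_mul, hQz, hQz'], fun y hy hne => ?_⟩
    simp only [evalAt_mul, ne_eq, mul_eq_zero, not_or] at hne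
    beta_reduce
    rw [h y hy.1 hne.1, h' y hy.2 hne.2, div_add_div _ _ hne.1 hne.2]
    simp [evalAt_mul, evalAt_add]
  regularAt_mul := by
    let _ := S.toTopologicalSpace
    rintro f g z ⟨U, P, Q, hU, hzU, hP, hQ, hQz, h⟩ ⟨V, P', Q', hV, hzV, hP', hQ', hQz', h'⟩
    have l : U ∩ V ⊆ U := Set.inter_subset_left
    have r : U ∩ V ⊆ V := Set.inter_subset_right
    refine ⟨U ∩ V, P * P', Q * Q', hU.inter hV, ⟨hzU, hzV⟩, (hP.mono l).mul (hP'.mono r),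
      (hQ.mono l).mul (hQ'.mono r), by simp [evalAt_mul, hQz, hQz'], fun y hy hne => ?_⟩
    simp only [evalAt_mul, ne_eq, mul_eq_zero, not_or] at hne
    beta_reduce
    rw [h y hy.1 hne.1, h' y hy.2 hne.2, div_mul_div_comm]
    simp [evalAt_mul]
  regularAt_inv := by
    rintro f z ⟨U, P, Q, hU, hzU, hP, hQ, hQz, h⟩ hz
    have hPz : evalAt P z ≠ 0 := fun h0 => hz (by rw [h z hzU hQz, h0, zero_div])
    refine ⟨⟨{y | y.1 ∈ U ∧ evalAt (P * Q) y ≠ 0}, fun y hy => ⟨U, P * Q, hU, hy.1, hP.mul hQ,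
      hy.2, fun _ h1 h2 => ⟨h1, h2⟩⟩, ⟨hzU, by simp [evalAt_mul, hPz, hQz]⟩, fun y hy => ?_⟩,
      U, Q * Q, P * Q, hU, hzU, hQ.mul hQ, hP.mul hQ, by simp [evalAt_mul, hPz, hQz],
      fun y hy hne => ?_⟩
    · simp only [Set.mem_ofPred_eq, evalAt_mul, ne_eq, mul_eq_zero, not_or] at hy
      rw [h y hy.1 hy.2.2]
      exact div_ne_zero hy.2.1 hy.2.2
    · simp only [evalAt_mul, ne_eq, mul_eq_zero, not_or] at hne
      beta_reduce
      rw [h y hy hne.2, inv_div, evalAt_mul, evalAt_mul, mul_div_mul_right _ _ hne.2]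

end FunSpace

open FunSpace

/-! ### Cell decompositions and vector bundles -/

/-- The finite family `cell` is a decomposition of `X` into affine cells of dimensions `dim`: the
cells are locally closed, pairwise disjoint, cover `X`, the `i`-th one is isomorphic to
`𝔸^(dim i)`, and the closure of a cell is the union of that cell and of cells of strictly smaller
dimension. -/
structure IsCellDecomposition {X ι : Type} [Finite ι] (S : FunSpace X) (cell : ι → Set X)
    (dim : ι → ℕ) : Prop where
  existsUnique_mem : ∀ x : X, ∃! i, x ∈ cell i
  isLocallyClosed : ∀ i, @IsLocallyClosed X S.toTopologicalSpace (cell i)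
  isomorphic_affine : ∀ i, Isomorphic (S.restrict (cell i)) (affine (Fin (dim i)))
  closure_subset : ∀ i j, (cell j ∩ closure[S.toTopologicalSpace] (cell i)).Nonempty →
    cell j ⊆ closure[S.toTopologicalSpace] (cell i) ∧ (j ≠ i → dim j < dim i)

/-- An algebraic vector bundle of rank `r` over the space with functions `S` on `X`: fibres
`Fiber x`, a structure on the total space `Σ x, Fiber x`, and local trivializations that are
isomorphisms and linear on the fibres. -/
structure VecBundle {X : Type} (S : FunSpace X) (r : ℕ) where
  Fiber : X → Type
  [addCommGroup : ∀ x, AddCommGroup (Fiber x)]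
  [module : ∀ x, Module ℂ (Fiber x)]
  space : FunSpace (Σ x, Fiber x)
  locally_trivial : ∀ x : X, ∃ U : Set X, IsOpen[S.toTopologicalSpace] U ∧ x ∈ U ∧
    ∃ φ : ∀ y : U, Fiber y ≃ₗ[ℂ] (Fin r → ℂ),
      IsIso (space.restrict {e : Σ x, Fiber x | e.1 ∈ U}) ((S.restrict U).prodAffine (Fin r))
        (fun e => (⟨e.1.1, e.2⟩, φ ⟨e.1.1, e.2⟩ e.1.2))

/-- The part of the total space lying over a subset of the base. -/
def VecBundle.over {X : Type} {S : FunSpace X} {r : ℕ} (E : VecBundle S r) (s : Set X) :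
    Set (Σ x, E.Fiber x) :=
  {e | e.1 ∈ s}

/-! ### Grassmannians and Schubert cells -/

/-- The `n × N` matrices of rank `n`. -/
def FullRank (n N : ℕ) : Type := {M : Matrix (Fin n) (Fin N) ℂ // M.rank = n}

/-- `FullRank n N` as a subspace of the affine space of all `n × N` matrices. -/
def fullRankSpace (n N : ℕ) : FunSpace (FullRank n N) :=
  (affine (Fin n × Fin N)).induced (fun M ij => M.1 ij.1 ij.2)

/-- The set of `n`-dimensional subspaces of `ℂ^N`. -/
def Gras (n N : ℕ) : Type := {W : Submodule ℂ (Fin N → ℂ) // Module.finrank ℂ W = n}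

/-- The point of the Grassmannian determined by a matrix of rank `n`: its row space. -/
def rowSpace {n N : ℕ} (M : FullRank n N) : Gras n N :=
  ⟨Submodule.span ℂ (Set.range M.1.row), by rw [← Matrix.rank_eq_finrank_span_row, M.2]⟩

/-- The Grassmannian as an algebraic variety: the quotient of the `n × N` matrices of rank `n` by
the action of `GL_n`, whose orbits are the fibres of `rowSpace`. -/
def grasSpace (n N : ℕ) : FunSpace (Gras n N) :=
  (fullRankSpace n N).quotient rowSpace

/-- The multi-indices `d_1 < ⋯ < d_n` in an `N`-element set. -/
abbrev MultiIndex (n N : ℕ) : Type := {I : Finset (Fin N) // I.card = n}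

/-- The Schubert cell of `I`: the row spaces of matrices `M` such that, for each `k`, the first `k`
columns of `M` span a space of dimension `#{i ∈ I | i is among the first k indices}`, i.e. the
image of the row space in the first `k` coordinates has this dimension. -/
def schubertCell {n N : ℕ} (I : MultiIndex n N) : Set (Gras n N) :=
  {W | ∀ k : ℕ, Module.finrank ℂ
      (W.1.map (LinearMap.funLeft ℂ ℂ (Subtype.val : {j : Fin N // j.val < k} → Fin N))) =
    (I.1.filter (fun i => i.val < k)).card}

/-- The dimension of the Schubert cell of `I`: the number of pairs `i < j` with `i ∈ I`, `j ∉ I`. -/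
def schubertDim {n N : ℕ} (I : MultiIndex n N) : ℕ :=
  (Finset.univ.filter (fun ij : Fin N × Fin N => ij.1 ∈ I.1 ∧ ij.2 ∉ I.1 ∧ ij.1 < ij.2)).card

/-! ### Linear systems -/

/-- Linear control systems `(A, B, C)` of type `(m, n, p)`. -/
@[ext]
structure LinSys (m n p : ℕ) : Type where
  A : Matrix (Fin n) (Fin n) ℂ
  B : Matrix (Fin n) (Fin m) ℂ
  C : Matrix (Fin p) (Fin n) ℂ

variable {m n p : ℕ}

/-- The matrix entries as coordinates on the space of systems. -/
def LinSys.coords (s : LinSys m n p) :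
    (Fin n × Fin n) ⊕ (Fin n × Fin m) ⊕ (Fin p × Fin n) → ℂ
  | .inl ij => s.A ij.1 ij.2
  | .inr (.inl ij) => s.B ij.1 ij.2
  | .inr (.inr ij) => s.C ij.1 ij.2

/-- The observability matrix with block rows `C, CA, …, CA^(n-1)`. -/
def LinSys.obsMatrix (s : LinSys m n p) : Matrix (Fin n × Fin p) (Fin n) ℂ :=
  Matrix.of fun ij l => (s.C * s.A ^ ij.1.val) ij.2 l

/-- Complete observability: the observability matrix has rank `n`. -/
def LinSys.Observable (s : LinSys m n p) : Prop := s.obsMatrix.rank = n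

/-- Equivalence of systems: base change in the state space. -/
def LinSys.Equiv (s₁ s₂ : LinSys m n p) : Prop :=
  ∃ g : GL (Fin n) ℂ, s₂.A = (g : Matrix (Fin n) (Fin n) ℂ) * s₁.A *
      ((g⁻¹ : GL (Fin n) ℂ) : Matrix (Fin n) (Fin n) ℂ) ∧
    s₂.B = (g : Matrix (Fin n) (Fin n) ℂ) * s₁.B ∧
    s₂.C = s₁.C * ((g⁻¹ : GL (Fin n) ℂ) : Matrix (Fin n) (Fin n) ℂ)

theorem LinSys.equiv_equivalence : Equivalence (LinSys.Equiv (m := m) (n := n) (p := p)) := by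
  refine ⟨fun S => ⟨1, by simp⟩, ?_, ?_⟩
  · rintro S T ⟨g, hA, hB, hC⟩
    refine ⟨g⁻¹, ?_, ?_, ?_⟩
    · rw [hA, inv_inv, Matrix.mul_assoc, Matrix.mul_assoc, Units.inv_mul, Matrix.mul_one,
        ← Matrix.mul_assoc, Units.inv_mul, Matrix.one_mul]
    · rw [hB, ← Matrix.mul_assoc, Units.inv_mul, Matrix.one_mul]
    · rw [hC, inv_inv, Matrix.mul_assoc, Units.inv_mul, Matrix.mul_one]
  · rintro S T R ⟨g, hA, hB, hC⟩ ⟨h, hA', hB', hC'⟩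
    refine ⟨h * g, ?_, ?_, ?_⟩
    · rw [hA', hA, mul_inv_rev, Units.val_mul, Units.val_mul]
      simp only [Matrix.mul_assoc]
    · rw [hB', hB, Units.val_mul, Matrix.mul_assoc]
    · rw [hC', hC, mul_inv_rev, Units.val_mul, Matrix.mul_assoc]

variable (m n p)

/-- The completely observable systems. -/
def ObsSystems : Type := {s : LinSys m n p // s.Observable}

/-- The completely observable systems as a subspace of the affine space of all systems. -/
def obsSystemsSpace : FunSpace (ObsSystems m n p) :=
  (affine ((Fin n × Fin n) ⊕ (Fin n × Fin m) ⊕ (Fin p × Fin n))).induced (fun s => s.1.coords)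

/-- Base change as an equivalence relation on the completely observable systems. -/
def obsSetoid : Setoid (ObsSystems m n p) where
  r s t := s.1.Equiv t.1
  iseqv := ⟨fun s => LinSys.equiv_equivalence.refl s.1, fun h => LinSys.equiv_equivalence.symm h,
    fun h h' => LinSys.equiv_equivalence.trans h h'⟩

/-- The orbits of `GL_n` on the completely observable systems. -/
def SysCo : Type := Quotient (obsSetoid m n p)

/-- The moduli space of completely observable systems: the orbit space with its quotient
structure. -/
def sysCoSpace : FunSpace (SysCo m n p) :=
  (obsSystemsSpace m n p).quotient (Quotient.mk (obsSetoid m n p))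

end ObsSys

end

/-!
The moduli space of completely observable systems is decomposed according to which linear
functionals on the state space are observed by the first outputs. For a system `(A, B, C)` with
rows `c_1, …, c_p` of `C`, let `V_j` be the span of all `c_l A ^ k` with `l ≤ j`. The spaces
`V_j` are invariant under `A`, increase with `j`, and end with the whole dual space, so their
dimensions form a sequence `s_1 ≤ ⋯ ≤ s_p = n`, the rank profile. The cells are the sets of
systems with a given rank profile; reading an `n`-element subset `I` of `p + n - 1` indices as a
lattice path, with its `p - 1` gaps separating `n` elements into `p` blocks, identifies rank
profiles with multi-indices (`exists_profile`).

On a cell, with `h_l = s_l - s_{l-1}`, the rows `c_l A ^ k` with `k < h_l` form a basis in which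
`c_l A ^ (h_l)` is an arbitrary vector `u_l` of `V_l` (Hermite normal form, `exists_chartPoint`).
The normal forms are a slice for the action of `GL_n`, and the coordinates of `u_l` and `B` are
invariant regular functions near the cell, so that the cell is an affine space of dimension
`∑ s_l + n m = d_I + n (m + 1)` (`profileCell_isomorphic`, `card_cellParam`).

Dimensions of spans are lower semicontinuous, so the closure of a cell only meets cells with
smaller or equal profiles. Conversely, to raise a single entry `s_i` of the profile by one
(`rankProfile_perturb`), choose an eigenvector `g` of `A` in the block of the next output, modulo
the flag, and replace `u_i` by `u_i + t g`: for `t ≠ 0` the first outputs up to `i` then observe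
exactly one dimension more, and nothing else changes. Hence the closure relation of the cells is
the pointwise order of the profiles.

For the Grassmannian, reduced echelon forms give the isomorphisms of Schubert cells with affine
spaces, and adding `t` in the new pivot columns degenerates one cell to another
(`schubertCell_subset_closure`). The closure relation is again the pointwise order, in terms of the
numbers `#(I ∩ {1, …, k})`, and the two orders agree under the bijection with profiles. The
assertion concerns only the decomposition of the total space into the preimages of Schubert cells,
and the trivial bundle of rank `n (m + 1)` has it: the closure of the preimage of a set is the
preimage of its closure (`mem_closure_trivialBundle_over`).

All morphisms are obtained from the universal properties of affine spaces, subspaces, quotients and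
products with affine spaces (`isMorphism_affine`, `isMorphism_induced`, `isMorphism_quotient_self`,
`isMorphism_prodAffine`).
-/

noncomputable section

namespace ObsSys

open FunSpace Matrix

/-! ### Morphisms of spaces with functions -/

namespace FunSpace

variable {X Y Z : Type}

/-- The functions regular at a given point form a subalgebra of all functions. -/
def regularSubalgebra (S : FunSpace X) (x : X) : Subalgebra ℂ (X → ℂ) where
  carrier := {f | S.RegularAt f x}
  mul_mem' hf hg := S.regularAt_mul _ _ x hf hg
  add_mem' hf hg := S.regularAt_add _ _ x hf hg
  algebraMap_mem' c := S.regularAt_const c x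

theorem regularAt_sum (S : FunSpace X) {ι : Type*} (s : Finset ι) (f : ι → X → ℂ) (x : X)
    (h : ∀ i ∈ s, S.RegularAt (f i) x) : S.RegularAt (fun z => ∑ i ∈ s, f i z) x := by
  have := (S.regularSubalgebra x).sum_mem (t := s) (f := f) h
  rwa [Finset.sum_fn] at this

theorem regularAt_prod (S : FunSpace X) {ι : Type*} (s : Finset ι) (f : ι → X → ℂ) (x : X)
    (h : ∀ i ∈ s, S.RegularAt (f i) x) : S.RegularAt (fun z => ∏ i ∈ s, f i z) x := by
  have := (S.regularSubalgebra x).prod_mem (t := s) (f := f) h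
  rwa [Finset.prod_fn] at this

theorem regularAt_pow (S : FunSpace X) (f : X → ℂ) (k : ℕ) (x : X)
    (h : S.RegularAt f x) : S.RegularAt (fun z => f z ^ k) x :=
  (S.regularSubalgebra x).pow_mem (x := f) h k

theorem regularAt_eval (S : FunSpace X) {σ : Type} (P : MvPolynomial σ ℂ) (f : X → σ → ℂ) (x : X)
    (h : ∀ i, S.RegularAt (fun z => f z i) x) : S.RegularAt (fun z => P.eval (f z)) x := by
  simp only [MvPolynomial.eval_eq]
  exact S.regularAt_sum _ _ _ fun d _ => S.regularAt_mul _ _ _ (S.regularAt_const _ _)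
    (S.regularAt_prod _ _ _ fun i _ => S.regularAt_pow _ _ _ (h i))

/-- A function agreeing with `P / Q` wherever `Q ≠ 0` is regular where `P` and `Q` are regular and
`Q` does not vanish. -/
theorem regularAt_of_eq_div (S : FunSpace X) {f P Q : X → ℂ} {x : X} {U : Set X}
    (hU : IsOpen[S.toTopologicalSpace] U) (hx : x ∈ U) (hP : S.RegularAt P x)
    (hQ : S.RegularAt Q x) (hQx : Q x ≠ 0) (h : ∀ y ∈ U, Q y ≠ 0 → f y = P y / Q y) :
    S.RegularAt f x := by
  let _ := S.toTopologicalSpace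
  obtain ⟨⟨V, hV, hxV, hne⟩, hinv⟩ := S.regularAt_inv Q x hQ hQx
  refine S.regularAt_congr _ f x (U ∩ V) (hU.inter hV) ⟨hx, hxV⟩ (fun y hy => ?_)
    (S.regularAt_mul _ _ _ hP hinv)
  rw [h y hy.1 (hne y hy.2), div_eq_mul_inv]

theorem isOpen_ne_zero (S : FunSpace X) {f : X → ℂ} (h : ∀ x, S.RegularAt f x) :
    IsOpen[S.toTopologicalSpace] {x | f x ≠ 0} := by
  let _ := S.toTopologicalSpace
  refine isOpen_iff_forall_mem_open.2 fun x hx => ?_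
  obtain ⟨⟨W, hW, hxW, hne⟩, -⟩ := S.regularAt_inv _ x (h x) hx
  exact ⟨W, hne, hW, hxW⟩

theorem IsMorphism.comp {S : FunSpace X} {T : FunSpace Y} {R : FunSpace Z} {ψ : Y → Z} {φ : X → Y}
    (hψ : IsMorphism T R ψ) (hφ : IsMorphism S T φ) : IsMorphism S R (ψ ∘ φ) := by
  let _ := S.toTopologicalSpace
  let _ := T.toTopologicalSpace
  let _ := R.toTopologicalSpace
  exact ⟨Continuous.comp hψ.1 hφ.1, fun f x hf => hφ.2 _ _ (hψ.2 f _ hf)⟩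

/-- Affine space represents tuples of regular functions. -/
theorem isMorphism_affine {S : FunSpace X} {σ : Type} {φ : X → σ → ℂ}
    (h : ∀ i x, S.RegularAt (fun z => φ z i) x) : IsMorphism S (affine σ) φ := by
  let _ := S.toTopologicalSpace
  let _ := (affine σ).toTopologicalSpace
  refine ⟨⟨fun U hU => isOpen_iff_forall_mem_open.2 fun x hx => ?_⟩, ?_⟩
  · obtain ⟨Q, hQ, hQU⟩ := hU (φ x) hx
    exact ⟨{y | Q.eval (φ y) ≠ 0}, fun y hy => hQU _ hy,
      S.isOpen_ne_zero fun y => S.regularAt_eval _ _ _ fun i => h i y, hQ⟩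
  · rintro f x ⟨P, Q, hQ, hf⟩
    exact S.regularAt_of_eq_div isOpen_univ trivial (S.regularAt_eval P φ x fun i => h i x)
      (S.regularAt_eval Q φ x fun i => h i x) hQ fun y _ hy => hf _ hy

theorem regularAt_coord {σ : Type} (i : σ) (x : σ → ℂ) :
    (affine σ).RegularAt (fun z => z i) x :=
  ⟨MvPolynomial.X i, 1, by simp, by simp⟩

theorem isMorphism_induced_self (T : FunSpace Y) (j : X → Y) : IsMorphism (T.induced j) T j := by
  let _ := T.toTopologicalSpace
  exact ⟨continuous_induced_dom, fun f x hf => ⟨f, Set.univ, hf, isOpen_univ, trivial,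
    fun _ _ => rfl⟩⟩

/-- Maps into an induced structure, such as that of a subset, are morphisms as soon as their
composites with the inclusion are. -/
theorem isMorphism_induced {S : FunSpace X} {T : FunSpace Z} {j : Y → Z} {φ : X → Y}
    (h : IsMorphism S T (j ∘ φ)) : IsMorphism S (T.induced j) φ := by
  let _ := S.toTopologicalSpace
  let _ := T.toTopologicalSpace
  refine ⟨continuous_induced_rng.2 h.1, ?_⟩
  rintro f x ⟨F, U, hF, hU, hxU, hf⟩
  exact S.regularAt_congr _ _ x _ (hU.preimage h.1) hxU (fun y hy => (hf _ hy).symm)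
    (h.2 F x hF)

theorem isMorphism_quotient_self (S : FunSpace X) (q : X → Y) :
    IsMorphism S (S.quotient q) q := by
  let _ := S.toTopologicalSpace
  exact ⟨continuous_coinduced_rng, fun f x ⟨V, hV, hx, h⟩ => h x hx⟩

/-- Together with `isMorphism_fst` and `regularAt_snd`: `prodAffine` is a product in the category of
spaces with functions. -/
theorem isMorphism_prodAffine {S : FunSpace X} {T : FunSpace Y} {σ : Type}
    {φ : X → Y × (σ → ℂ)} (h1 : IsMorphism S T (fun x => (φ x).1))
    (h2 : ∀ i x, S.RegularAt (fun z => (φ z).2 i) x) : IsMorphism S (T.prodAffine σ) φ := by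
  let _ := S.toTopologicalSpace
  let _ := T.toTopologicalSpace
  let _ := (T.prodAffine σ).toTopologicalSpace
  have key : ∀ (U : Set Y) (Q : MvPolynomial σ (Y → ℂ)), RegularCoeffs T U Q → ∀ x,
      (φ x).1 ∈ U → S.RegularAt (fun z => evalAt Q (φ z)) x := by
    intro U Q hQ x hx
    simp only [evalAt, MvPolynomial.eval_map, MvPolynomial.eval₂_eq]
    exact S.regularAt_sum _ _ _ fun d _ => S.regularAt_mul _ _ _ (h1.2 _ _ (hQ d _ hx))
      (S.regularAt_prod _ _ _ fun i _ => S.regularAt_pow _ _ _ (h2 i x))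
  refine ⟨⟨fun W hW => isOpen_iff_forall_mem_open.2 fun x hx => ?_⟩, ?_⟩
  · obtain ⟨U, Q, hU, hxU, hQ, hQx, hW⟩ := hW (φ x) hx
    obtain ⟨⟨V, hV, hxV, hne⟩, -⟩ := S.regularAt_inv _ x (key U Q hQ x hxU) hQx
    exact ⟨(fun x => (φ x).1) ⁻¹' U ∩ V, fun y hy => hW _ hy.1 (hne _ hy.2),
      (hU.preimage h1.1).inter hV, hxU, hxV⟩
  · rintro f x ⟨U, P, Q, hU, hxU, hP, hQ, hQx, hf⟩
    exact S.regularAt_of_eq_div (hU.preimage h1.1) hxU (key U P hP x hxU) (key U Q hQ x hxU) hQx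
      fun y hy hne => hf _ hy hne

theorem isMorphism_fst (S : FunSpace X) (σ : Type) :
    IsMorphism (S.prodAffine σ) S Prod.fst := by
  let _ := S.toTopologicalSpace
  let _ := (S.prodAffine σ).toTopologicalSpace
  refine ⟨⟨fun U hU z hz => ⟨U, MvPolynomial.C (fun _ => 1), hU, hz, regularCoeffs_C S _ 1,
    by simp [evalAt_C], fun _ h _ => h⟩⟩, fun f z hf => ?_⟩
  obtain ⟨U, hU, hzU, hfU⟩ := S.regularAt_open f _ hf
  refine ⟨U, MvPolynomial.C f, MvPolynomial.C (fun _ => 1), hU, hzU, fun k y hy => ?_,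
    regularCoeffs_C S _ 1, by simp [evalAt_C], fun z' _ _ => by simp [evalAt]⟩
  classical
  rw [MvPolynomial.coeff_C]
  split_ifs
  · exact hfU y hy
  · exact S.regularAt_const 0 y

theorem regularAt_snd (S : FunSpace X) {σ : Type} (i : σ) (z : X × (σ → ℂ)) :
    (S.prodAffine σ).RegularAt (fun z => z.2 i) z := by
  let _ := S.toTopologicalSpace
  refine ⟨Set.univ, MvPolynomial.X i, MvPolynomial.C (fun _ => 1), isOpen_univ, trivial,
    fun k y hy => ?_, regularCoeffs_C S _ 1, by simp [evalAt_C], fun z' _ _ => by simp [evalAt]⟩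
  classical
  rw [MvPolynomial.coeff_X]
  split_ifs
  · exact S.regularAt_const 1 y
  · exact S.regularAt_const 0 y

theorem isIso_of_isMorphism {S : FunSpace X} {T : FunSpace Y} {φ : X → Y} {ψ : Y → X}
    (hφ : IsMorphism S T φ) (hψ : IsMorphism T S ψ) (h1 : ∀ x, ψ (φ x) = x)
    (h2 : ∀ y, φ (ψ y) = y) : IsIso S T φ :=
  ⟨⟨φ, ψ, h1, h2⟩, rfl, hφ, hψ⟩

theorem Isomorphic.trans {S : FunSpace X} {T : FunSpace Y} {R : FunSpace Z}
    (h : Isomorphic S T) (h' : Isomorphic T R) : Isomorphic S R := by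
  obtain ⟨_, e, rfl, h1, h2⟩ := h
  obtain ⟨_, e', rfl, h1', h2'⟩ := h'
  exact ⟨_, e.trans e', rfl, h1'.comp h1, h2.comp h2'⟩

theorem affine_isomorphic_of_card {σ : Type} [Fintype σ] {d : ℕ} (h : Fintype.card σ = d) :
    Isomorphic (affine σ) (affine (Fin d)) := by
  let e := Fintype.equivFinOfCardEq h
  exact ⟨fun x i => x (e.symm i), isIso_of_isMorphism (ψ := fun x i => x (e i))
    (isMorphism_affine fun i x => regularAt_coord _ x)
    (isMorphism_affine fun i x => regularAt_coord _ x) (by simp) (by simp)⟩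

/-! ### Matrices of regular functions -/

section Matrix

variable (S : FunSpace X) {ι κ ν : Type*} [Fintype κ]

/-- All entries of a matrix of functions are regular at `x`. -/
def MatRegularAt (M : X → Matrix ι ν ℂ) (x : X) : Prop :=
  ∀ i j, S.RegularAt (fun z => M z i j) x

variable {S}

theorem MatRegularAt.mul {M : X → Matrix ι κ ℂ} {N : X → Matrix κ ν ℂ} {x : X}
    (hM : S.MatRegularAt M x) (hN : S.MatRegularAt N x) :
    S.MatRegularAt (fun z => M z * N z) x := fun i j => by
  simp only [Matrix.mul_apply]
  exact S.regularAt_sum _ _ _ fun k _ => S.regularAt_mul _ _ _ (hM i k) (hN k j)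

theorem matRegularAt_const (M : Matrix ι ν ℂ) (x : X) : S.MatRegularAt (fun _ => M) x :=
  fun _ _ => S.regularAt_const _ _

theorem MatRegularAt.pow [DecidableEq κ] {M : X → Matrix κ κ ℂ} {x : X}
    (hM : S.MatRegularAt M x) (k : ℕ) :
    S.MatRegularAt (fun z => M z ^ k) x := by
  induction k with
  | zero => simpa using matRegularAt_const (S := S) 1 x
  | succ k ih => simpa only [pow_succ] using ih.mul hM

theorem MatRegularAt.det [DecidableEq κ] {M : X → Matrix κ κ ℂ} {x : X} (hM : S.MatRegularAt M x) :
    S.RegularAt (fun z => (M z).det) x := by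
  simp only [Matrix.det_apply']
  exact S.regularAt_sum _ _ _ fun s _ => S.regularAt_mul _ _ _ (S.regularAt_const _ _)
    (S.regularAt_prod _ _ _ fun i _ => hM _ _)

theorem MatRegularAt.inv [DecidableEq κ] {M : X → Matrix κ κ ℂ} {x : X} (hM : S.MatRegularAt M x)
    (hx : (M x).det ≠ 0) : S.MatRegularAt (fun z => (M z)⁻¹) x := fun i j => by
  simp only [Matrix.inv_def, Matrix.smul_apply, Ring.inverse_eq_inv', smul_eq_mul,
    Matrix.adjugate_apply]
  refine S.regularAt_mul _ _ _ (S.regularAt_inv _ _ hM.det hx).2 (MatRegularAt.det fun a b => ?_)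
  simp only [Matrix.updateRow_apply]
  split_ifs
  · exact S.regularAt_const _ _
  · exact hM a b

end Matrix

/-- The dimension of the span of a family of vectors depending regularly on a point is lower
semicontinuous. -/
theorem isOpen_le_finrank_span (S : FunSpace X) {ι κ : Type*} [Fintype κ] [DecidableEq κ]
    (w : X → ι → κ → ℂ) (hw : ∀ i c x, S.RegularAt (fun z => w z i c) x) (d : ℕ) :
    IsOpen[S.toTopologicalSpace]
      {x | d ≤ Module.finrank ℂ (Submodule.span ℂ (Set.range (w x)))} := by
  let _ := S.toTopologicalSpace
  refine isOpen_iff_forall_mem_open.2 fun x hx => ?_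
  -- `d` linearly independent members of the family at `x`
  obtain ⟨f, hf⟩ : ∃ f : Fin d → ι, LinearIndependent ℂ (fun a => w x (f a)) := by
    obtain ⟨b, hb, hspan, hli⟩ := exists_linearIndependent ℂ (Set.range (w x))
    have hfin : b.Finite := hli.set_finite_of_isNoetherian
    have : Fintype b := hfin.fintype
    have hcard : d ≤ Fintype.card b := by
      rw [Set.mem_ofPred_eq, ← hspan, finrank_span_set_eq_card hli] at hx
      rwa [← Set.toFinset_card]
    choose g hg using fun y : b => hb y.2
    obtain ⟨e⟩ : Nonempty (Fin d ↪ b) :=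
      Function.Embedding.nonempty_of_card_le (by simpa using hcard)
    refine ⟨fun a => g (e a), ?_⟩
    have := hli.comp e e.injective
    simp only [hg]
    exact this
  -- a left inverse `Q` of these vectors: the determinant of their product with `Q` is the regular
  -- function whose nonvanishing keeps them independent
  obtain ⟨L, hL⟩ := LinearMap.exists_leftInverse_of_injective
    (Fintype.linearCombination ℂ (fun a => w x (f a)))
      (LinearMap.ker_eq_bot.2 (linearIndependent_iff_injective_fintypeLinearCombination.1 hf))
  let Q : Matrix κ (Fin d) ℂ := Matrix.of fun c b => L (Pi.single c 1) b
  let W : X → Matrix (Fin d) κ ℂ := fun z => Matrix.of fun a => w z (f a)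
  have hreg : ∀ y, S.RegularAt (fun z => (W z * Q).det) y := fun y =>
    MatRegularAt.det (MatRegularAt.mul (fun a c => hw _ _ _) (matRegularAt_const _ _))
  have hWx : W x * Q = 1 := by
    ext a b
    have h1 : L (w x (f a)) b = (Pi.single a 1 : Fin d → ℂ) b := by
      have := congrArg (fun T => T (Pi.single a 1) b) hL
      simpa [Fintype.linearCombination_apply_single] using this
    have h2 : w x (f a) = ∑ c, w x (f a) c • (Pi.single c 1 : κ → ℂ) := by
      ext c'; simp [Finset.sum_apply, Pi.single_apply]
    rw [h2] at h1
    simp only [map_sum, map_smul, Finset.sum_apply, Pi.smul_apply, smul_eq_mul] at h1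
    rw [Matrix.mul_apply, Matrix.one_apply]
    simpa [W, Q, Pi.single_apply, eq_comm] using h1
  refine ⟨_, fun y hy => ?_, S.isOpen_ne_zero hreg, ?_⟩
  · have hli : LinearIndependent ℂ (fun a => w y (f a)) := by
      rw [linearIndependent_iff_injective_fintypeLinearCombination, injective_iff_map_eq_zero]
      intro v hv
      have hv' : Matrix.vecMul v (W y) = 0 := by
        ext c
        have := congrFun hv c
        simpa [Fintype.linearCombination_apply, Matrix.vecMul, dotProduct, W] using this
      refine Matrix.eq_zero_of_vecMul_eq_zero hy ?_
      rw [← Matrix.vecMul_vecMul, hv', Matrix.zero_vecMul]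
    have h1 := finrank_span_eq_card hli
    rw [Fintype.card_fin] at h1
    rw [Set.mem_ofPred_eq, ← h1]
    refine Submodule.finrank_mono (Submodule.span_mono ?_)
    rintro _ ⟨a, rfl⟩
    exact ⟨f a, rfl⟩
  · simp [hWx]

/-! ### Cells -/

/-- A point which is the value at `0` of a curve lying in `s` away from `0` is in the closure of
`s`. -/
theorem mem_closure_of_curve {S : FunSpace X} {φ : (Unit → ℂ) → X}
    (hφ : IsMorphism (affine Unit) S φ) {s : Set X} (h : ∀ t : Unit → ℂ, t ≠ 0 → φ t ∈ s) :
    φ 0 ∈ closure[S.toTopologicalSpace] s := by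
  let _ := S.toTopologicalSpace
  let _ := (affine Unit).toTopologicalSpace
  refine mem_closure_iff.2 fun U hU h0 => ?_
  obtain ⟨Q, hQ, hQU⟩ := (show IsOpen (φ ⁻¹' U) from hU.preimage hφ.1) 0 h0
  have hne : Q * MvPolynomial.X () ≠ 0 := by
    refine mul_ne_zero (fun h => hQ (by simp [h])) (MvPolynomial.X_ne_zero _)
  obtain ⟨t, ht⟩ : ∃ t, (Q * MvPolynomial.X ()).eval t ≠ 0 := by
    by_contra! hc
    exact hne (MvPolynomial.funext fun t => by rw [hc t, map_zero])
  rw [map_mul, MvPolynomial.eval_X] at ht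
  exact ⟨φ t, hQU t (left_ne_zero_of_mul ht), h t fun h0 => right_ne_zero_of_mul ht (by simp [h0])⟩

/-- A subset of a quotient over which there is a slice `sl`, with coordinates given by functions
`F` which are regular near the subset, is an affine space. -/
theorem isomorphic_affine_of_slice {S : FunSpace X} {q : X → Y} {s : Set Y} {σ : Type}
    {sl : (σ → ℂ) → X} (hsl : IsMorphism (affine σ) S sl) (hmem : ∀ a, q (sl a) ∈ s)
    (F : Y → σ → ℂ) (V : Set Y) (hV : IsOpen[S.toTopologicalSpace] (q ⁻¹' V)) (hsV : s ⊆ V)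
    (hF : ∀ i x, q x ∈ V → S.RegularAt (fun z => F (q z) i) x)
    (h1 : ∀ a, F (q (sl a)) = a) (h2 : ∀ y ∈ s, q (sl (F y)) = y) :
    Isomorphic ((S.quotient q).restrict s) (affine σ) := by
  refine ⟨fun y => F y.1, isIso_of_isMorphism (ψ := fun a => ⟨q (sl a), hmem a⟩) ?_ ?_ ?_ ?_⟩
  · refine isMorphism_affine fun i y => ?_
    exact (isMorphism_induced_self _ _).2 (fun z => F z i) y ⟨V, hV, hsV y.2, fun x hx => hF i x hx⟩
  · exact isMorphism_induced ((isMorphism_quotient_self S q).comp hsl)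
  · exact fun y => Subtype.ext (h2 y.1 y.2)
  · exact h1

end FunSpace

/-- A criterion for cell decompositions whose closure relation is the order `le`. -/
theorem isCellDecomposition_of_le {X ι : Type} [Finite ι] {S : FunSpace X} {cell : ι → Set X}
    {dim : ι → ℕ} (le : ι → ι → Prop) (h1 : ∀ x : X, ∃! i, x ∈ cell i)
    (h2 : ∀ i, @IsLocallyClosed X S.toTopologicalSpace (cell i))
    (h3 : ∀ i, Isomorphic (S.restrict (cell i)) (affine (Fin (dim i))))
    (h4 : ∀ i j, (cell j ∩ closure[S.toTopologicalSpace] (cell i)).Nonempty → le j i)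
    (h5 : ∀ i j, le j i → cell j ⊆ closure[S.toTopologicalSpace] (cell i))
    (h6 : ∀ i j, le j i → j ≠ i → dim j < dim i) :
    IsCellDecomposition S cell dim :=
  ⟨h1, h2, h3, fun i j h => ⟨h5 i j (h4 i j h), h6 i j (h4 i j h)⟩⟩

/-- In such a decomposition the closure relation of the cells is exactly `le`. -/
theorem IsCellDecomposition.subset_closure_iff {X ι : Type} [Finite ι] {S : FunSpace X}
    {cell : ι → Set X} {dim : ι → ℕ} {le : ι → ι → Prop} (h : IsCellDecomposition S cell dim)
    (h4 : ∀ i j, (cell j ∩ closure[S.toTopologicalSpace] (cell i)).Nonempty → le j i)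
    (h5 : ∀ i j, le j i → cell j ⊆ closure[S.toTopologicalSpace] (cell i)) (i j : ι) :
    cell j ⊆ closure[S.toTopologicalSpace] (cell i) ↔ le j i := by
  refine ⟨fun hsub => h4 i j ?_, h5 i j⟩
  obtain ⟨_, e, -⟩ := h.isomorphic_affine j
  exact ⟨_, (e.symm 0).2, hsub (e.symm 0).2⟩

/-! ### Combinatorics of multi-indices -/

/-- The number of elements of `S` among the first `k` indices. -/
def countBelow {N : ℕ} (S : Finset (Fin N)) (k : ℕ) : ℕ := (S.filter (fun i => i.val < k)).card

theorem countBelow_eq_card {N c : ℕ} {S : Finset (Fin N)} (h : S.card = c) (k : ℕ) :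
    countBelow S k =
      (Finset.univ.filter fun a : Fin c => (S.orderEmbOfFin h a).val < k).card := by
  have hS : S = Finset.univ.map (S.orderEmbOfFin h).toEmbedding :=
    (S.map_orderEmbOfFin_univ h).symm
  rw [countBelow]
  conv_lhs => rw [hS]
  rw [Finset.filter_map, Finset.card_map]
  rfl

/-- The increasing enumeration of `S` and its counting function are inverse to each other. -/
theorem orderEmb_lt_iff {N c : ℕ} {S : Finset (Fin N)} (h : S.card = c) (l : Fin c) (k : ℕ) :
    (S.orderEmbOfFin h l).val < k ↔ l.val < countBelow S k := by
  rw [countBelow_eq_card h]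
  set e := S.orderEmbOfFin h
  constructor
  · intro hl
    have hsub : Finset.Iic l ⊆ Finset.univ.filter fun a : Fin c => (e a).val < k := by
      intro a ha
      have : e a ≤ e l := e.monotone (Finset.mem_Iic.1 ha)
      simpa using lt_of_le_of_lt (Fin.le_def.1 this) hl
    have := Finset.card_le_card hsub
    rw [Fin.card_Iic] at this
    omega
  · intro hl
    by_contra hk
    have hsub : (Finset.univ.filter fun a : Fin c => (e a).val < k) ⊆ Finset.Iio l := by
      intro a ha
      rw [Finset.mem_Iio]
      by_contra hal
      have h1 : e l ≤ e a := e.monotone (not_lt.1 hal)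
      have h2 := (Finset.mem_filter.1 ha).2
      have h3 := Fin.le_def.1 h1
      omega
    have := Finset.card_le_card hsub
    rw [Fin.card_Iio] at this
    omega

theorem countBelow_orderEmb {N c : ℕ} {S : Finset (Fin N)} (h : S.card = c) (l : Fin c) :
    countBelow S (S.orderEmbOfFin h l).val = l := by
  apply le_antisymm
  · have := (orderEmb_lt_iff h l (S.orderEmbOfFin h l).val).not.1 (lt_irrefl _)
    omega
  · by_contra hlt
    push Not at hlt
    have hc : countBelow S (S.orderEmbOfFin h l).val < c := hlt.trans l.2
    have h1 := (orderEmb_lt_iff h ⟨_, hc⟩ (S.orderEmbOfFin h l).val).not.2 (lt_irrefl _)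
    exact h1 ((S.orderEmbOfFin h).strictMono hlt)

theorem countBelow_le_iff {N c : ℕ} {S T : Finset (Fin N)} (hS : S.card = c) (hT : T.card = c) :
    (∀ k, countBelow S k ≤ countBelow T k) ↔
      ∀ l, T.orderEmbOfFin hT l ≤ S.orderEmbOfFin hS l := by
  constructor
  · intro h l
    have h1 := (orderEmb_lt_iff hS l ((S.orderEmbOfFin hS l).val + 1)).1 (Nat.lt_succ_self _)
    have h2 := (orderEmb_lt_iff hT l _).2 (h1.trans_le (h _))
    exact Fin.le_def.2 (Nat.lt_succ_iff.1 h2)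
  · intro h k
    by_contra! hlt
    have hc : countBelow T k < c :=
      hlt.trans_le ((Finset.card_filter_le _ _).trans hS.le)
    have h1 := (orderEmb_lt_iff hS ⟨_, hc⟩ k).2 hlt
    exact lt_irrefl _ ((orderEmb_lt_iff hT ⟨_, hc⟩ k).1 ((Fin.le_def.1 (h _)).trans_lt h1))

theorem countBelow_add_compl {N : ℕ} (S : Finset (Fin N)) {k : ℕ} (hk : k ≤ N) :
    countBelow S k + countBelow Sᶜ k = k := by
  rw [countBelow, countBelow, ← Finset.card_union_of_disjoint, ← Finset.filter_union,
    Finset.union_compl]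
  · have : (Finset.univ.filter fun i : Fin N => i.val < k) =
        Finset.univ.map (Fin.castLEEmb hk) := by
      ext i
      simp only [Finset.mem_filter, Finset.mem_univ, true_and, Finset.mem_map, Fin.castLEEmb_apply]
      exact ⟨fun h => ⟨⟨i, h⟩, rfl⟩, by rintro ⟨a, rfl⟩; exact a.2⟩
    rw [this, Finset.card_map, Finset.card_univ, Fintype.card_fin]
  · exact Finset.disjoint_filter_filter disjoint_compl_right

theorem countBelow_of_le {N : ℕ} (S : Finset (Fin N)) {k : ℕ} (hk : N ≤ k) :
    countBelow S k = S.card := by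
  rw [countBelow, Finset.filter_true_of_mem]
  exact fun i _ => i.2.trans_le hk

namespace MultiIndex

variable {n N : ℕ}

/-- The order of the closure relation: the cell of `J` lies in the closure of the cell of `I` if
and only if `Le J I`. -/
def Le (J I : MultiIndex n N) : Prop := ∀ k, countBelow J.1 k ≤ countBelow I.1 k

/-- The `l`-th element of a multi-index. -/
def pos (I : MultiIndex n N) : Fin n ↪o Fin N := I.1.orderEmbOfFin I.2

theorem card_compl (I : MultiIndex n N) {c : ℕ} (hc : N = c + n) : (I.1ᶜ).card = c := by
  rw [Finset.card_compl, I.2, Fintype.card_fin, hc, Nat.add_sub_cancel]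

/-- The `l`-th index which does not belong to a multi-index. -/
def gap (I : MultiIndex n N) {c : ℕ} (hc : N = c + n) : Fin c ↪o Fin N :=
  I.1ᶜ.orderEmbOfFin (I.card_compl hc)

theorem le_card (I : MultiIndex n N) : n ≤ N := by
  simpa [I.2] using Finset.card_le_univ I.1

theorem le_iff_pos (J I : MultiIndex n N) : J.Le I ↔ ∀ l, I.pos l ≤ J.pos l :=
  countBelow_le_iff J.2 I.2

theorem le_iff_gap (J I : MultiIndex n N) {c : ℕ} (hc : N = c + n) :
    J.Le I ↔ ∀ l, J.gap hc l ≤ I.gap hc l := by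
  rw [gap, gap, ← countBelow_le_iff]
  refine forall_congr' fun k => ?_
  rcases le_total k N with hk | hk
  · have h1 := countBelow_add_compl I.1 hk
    have h2 := countBelow_add_compl J.1 hk
    omega
  · rw [countBelow_of_le _ hk, countBelow_of_le _ hk, countBelow_of_le _ hk,
      countBelow_of_le _ hk, I.2, J.2, I.card_compl hc, J.card_compl hc]
    exact ⟨fun _ => le_rfl, fun _ => le_rfl⟩

theorem eq_of_le_of_le {I J : MultiIndex n N} (h : I.Le J) (h' : J.Le I) : I = J := by
  rw [le_iff_pos] at h h'
  have : I.pos = J.pos := by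
    ext l
    exact congrArg Fin.val (le_antisymm (h' l) (h l))
  apply Subtype.ext
  apply Finset.coe_injective
  rw [← Finset.range_orderEmbOfFin I.1 I.2, ← Finset.range_orderEmbOfFin J.1 J.2]
  exact congrArg (fun e : Fin n ↪o Fin N => Set.range e) this

theorem countBelow_gap (I : MultiIndex n N) {c : ℕ} (hc : N = c + n) (l : Fin c) :
    countBelow I.1 (I.gap hc l).val + l = (I.gap hc l).val := by
  have h1 := countBelow_add_compl I.1 (I.gap hc l).2.le
  have h2 := countBelow_orderEmb (I.card_compl hc) l
  rw [gap] at *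
  omega

theorem schubertDim_eq (I : MultiIndex n N) {c : ℕ} (hc : N = c + n) :
    schubertDim I = ∑ l : Fin c, countBelow I.1 (I.gap hc l).val := by
  classical
  have hS : I.1ᶜ = Finset.univ.map (I.gap hc).toEmbedding :=
    (I.1ᶜ.map_orderEmbOfFin_univ (I.card_compl hc)).symm
  have h1 : schubertDim I = ∑ y ∈ I.1ᶜ, countBelow I.1 y.val := by
    rw [schubertDim, Finset.card_eq_sum_card_fiberwise (f := Prod.snd) (t := I.1ᶜ)]
    · refine Finset.sum_congr rfl fun y hy => ?_
      rw [countBelow]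
      refine Finset.card_bij (fun a _ => a.1) ?_ ?_ ?_
      · rintro ⟨a, b⟩ h
        simp only [Finset.mem_filter, Finset.mem_univ, true_and] at h ⊢
        obtain ⟨⟨h1, h2, h3⟩, rfl⟩ := h
        exact ⟨h1, h3⟩
      · rintro ⟨a, b⟩ h ⟨a', b'⟩ h' rfl
        simp only [Finset.mem_filter, Finset.mem_univ, true_and] at h h'
        rw [h.2, h'.2]
      · intro a ha
        simp only [Finset.mem_filter] at ha
        exact ⟨(a, y), by simpa using ⟨ha.1, by simpa using hy, ha.2⟩, rfl⟩
    · rintro ⟨a, b⟩ h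
      simp only [Finset.coe_filter, Finset.mem_univ, true_and, Set.mem_ofPred_eq] at h
      simpa using h.2.1
  rw [h1, hS, Finset.sum_map]
  rfl

theorem schubertDim_lt {I J : MultiIndex n N} (h : J.Le I) (hne : J ≠ I) :
    schubertDim J < schubertDim I := by
  have hc : N = (N - n) + n := (Nat.sub_add_cancel I.le_card).symm
  have hle := (J.le_iff_gap I hc).1 h
  rw [J.schubertDim_eq hc, I.schubertDim_eq hc]
  have key : ∀ l, countBelow J.1 (J.gap hc l).val ≤ countBelow I.1 (I.gap hc l).val := by
    intro l
    have h1 := J.countBelow_gap hc l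
    have h2 := I.countBelow_gap hc l
    have h3 := Fin.le_def.1 (hle l)
    omega
  refine Finset.sum_lt_sum (fun l _ => key l) ?_
  by_contra! hcon
  refine hne (eq_of_le_of_le h ((I.le_iff_gap J hc).2 fun l => ?_))
  have h1 := J.countBelow_gap hc l
  have h2 := I.countBelow_gap hc l
  have h3 := hcon l (Finset.mem_univ _)
  rw [Fin.le_def]
  omega

end MultiIndex

/-! ### Rank profiles -/

/-- The possible sequences `s 0 ≤ ⋯ ≤ s (p - 1) = n` of dimensions of the spaces observed by the
first outputs of a completely observable system. Without outputs (`p = 0`) such a system has state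
space of dimension `n = 0`. -/
structure IsRankProfile {p : ℕ} (n : ℕ) (s : Fin p → ℕ) : Prop where
  monotone : Monotone s
  last : ∀ j : Fin p, j.val + 1 = p → s j = n
  zero : p = 0 → n = 0

theorem IsRankProfile.le {p n : ℕ} {s : Fin p → ℕ} (h : IsRankProfile n s) (j : Fin p) :
    s j ≤ n := by
  have hp := j.2
  rw [← h.last ⟨p - 1, by omega⟩ (by simp only; omega)]
  exact h.monotone (Fin.le_def.2 (by simp only; omega))

/-- Reading a multi-index as a lattice path, the `p - 1` gaps separate its `n` elements into `p`
blocks, and the partial sums of the block sizes form a rank profile. This is a bijection, which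
takes the closure order to the pointwise order. -/
theorem exists_profile (n p : ℕ) :
    ∃ s : MultiIndex n (p + n - 1) → Fin p → ℕ,
      (∀ I, IsRankProfile n (s I)) ∧ (∀ t, IsRankProfile n t → ∃ I, s I = t) ∧
      (∀ J I, MultiIndex.Le J I ↔ ∀ j, s J j ≤ s I j) ∧
      ∀ I, ∑ j, s I j = schubertDim I + n := by
  rcases p with _ | q
  · refine ⟨fun _ j => j.elim0, fun I => ⟨fun a => a.elim0, fun a => a.elim0, fun _ => ?_⟩,
      fun t ht => ?_, fun J I => ⟨fun _ j => j.elim0, fun _ => ?_⟩, fun I => ?_⟩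
    · have := I.le_card; omega
    · obtain rfl := ht.zero rfl
      exact ⟨⟨∅, rfl⟩, funext fun j => j.elim0⟩
    · have hn := I.le_card
      obtain rfl : n = 0 := by omega
      rw [MultiIndex.le_iff_pos]
      exact fun l => l.elim0
    · have hn := I.le_card
      obtain rfl : n = 0 := by omega
      have : schubertDim I = 0 := by
        rw [schubertDim, Finset.card_eq_zero]
        exact Finset.eq_empty_of_forall_notMem fun a => a.1.elim0
      simp [this]
  · have hN : q + 1 + n - 1 = q + n := by omega
    generalize q + 1 + n - 1 = N at hN
    have hge : ∀ (I : MultiIndex n N) (l : Fin q), countBelow I.1 (I.gap hN l).val ≤ n :=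
      fun I l => (Finset.card_filter_le _ _).trans I.2.le
    refine ⟨fun I => Fin.lastCases n fun l => countBelow I.1 (I.gap hN l).val, fun I => ?_,
      fun t ht => ?_, fun J I => ?_, fun I => ?_⟩
    · refine ⟨fun a b hab => ?_, fun j hj => ?_, fun h => absurd h (Nat.succ_ne_zero _)⟩
      · induction b using Fin.lastCases with
        | last =>
          induction a using Fin.lastCases with
          | last => exact le_rfl
          | cast a => simpa using hge I a
        | cast b =>
          induction a using Fin.lastCases with
          | last => exact absurd hab (not_le.2 (Fin.castSucc_lt_last b))
          | cast a =>
            simp only [Fin.lastCases_castSucc]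
            refine Finset.card_le_card (Finset.monotone_filter_right _ fun i _ hi => ?_)
            exact hi.trans_le
              (Fin.le_def.1 ((I.gap hN).monotone (Fin.castSucc_le_castSucc_iff.1 hab)))
      · obtain rfl : j = Fin.last q := Fin.ext (by simpa using hj)
        simp
    · have hlt : ∀ j : Fin q, t j.castSucc + j < N := fun j => by
        have := ht.le j.castSucc
        omega
      let f : Fin q → Fin N := fun j => ⟨t j.castSucc + j, hlt j⟩
      have hf : StrictMono f := fun a b hab => by
        have := ht.monotone (Fin.castSucc_le_castSucc_iff.2 hab.le)
        have := Fin.lt_def.1 hab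
        rw [Fin.lt_def]
        simp only [f]
        omega
      have hcard : (Finset.univ.image f)ᶜ.card = n := by
        rw [Finset.card_compl, Finset.card_image_of_injective _ hf.injective]
        simp [hN]
      let I : MultiIndex n N := ⟨(Finset.univ.image f)ᶜ, hcard⟩
      have hgap : ∀ l, I.gap hN l = f l := fun l =>
        (congrFun (Finset.orderEmbOfFin_unique (I.card_compl hN) (fun x => by simp [I]) hf) l).symm
      refine ⟨I, funext fun j => ?_⟩
      induction j using Fin.lastCases with
      | last => simpa using (ht.last (Fin.last q) (by simp)).symm
      | cast l =>
        have h1 := I.countBelow_gap hN l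
        have h2 := congrArg Fin.val (hgap l)
        simp only [f] at h2
        simp only [Fin.lastCases_castSucc]
        omega
    · rw [MultiIndex.le_iff_gap J I hN, Fin.forall_fin_succ']
      simp only [Fin.lastCases_castSucc, Fin.lastCases_last, le_refl, and_true]
      refine forall_congr' fun l => ?_
      have h1 := I.countBelow_gap hN l
      have h2 := J.countBelow_gap hN l
      rw [Fin.le_def]
      omega
    · rw [Fin.sum_univ_castSucc, I.schubertDim_eq hN]
      simp

theorem sum_Iic_succ {p : ℕ} (h : Fin p → ℕ) {i i' : Fin p} (hi : i'.val = i.val + 1) :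
    ∑ l ∈ Finset.Iic i', h l = ∑ l ∈ Finset.Iic i, h l + h i' := by
  have : Finset.Iic i' = insert i' (Finset.Iic i) := by
    ext x
    simp only [Finset.mem_Iic, Finset.mem_insert, Fin.le_def, Fin.ext_iff]
    omega
  rw [this, Finset.sum_insert, add_comm]
  rw [Finset.mem_Iic, Fin.le_def]
  omega

theorem sum_Iic_zero {p : ℕ} (h : Fin p → ℕ) {i : Fin p} (hi : i.val = 0) :
    ∑ l ∈ Finset.Iic i, h l = h i := by
  have : Finset.Iic i = {i} := by
    ext x
    rw [Finset.mem_Iic, Finset.mem_singleton, Fin.le_def, Fin.ext_iff]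
    omega
  rw [this, Finset.sum_singleton]

/-- A monotone sequence is the sequence of partial sums of its increments. -/
theorem exists_partialSums {p : ℕ} {s : Fin p → ℕ} (hs : Monotone s) :
    ∃ h : Fin p → ℕ, ∀ j, s j = ∑ l ∈ Finset.Iic j, h l := by
  rcases p with _ | q
  · exact ⟨s, fun j => j.elim0⟩
  refine ⟨Fin.cases (s 0) fun l => s l.succ - s l.castSucc, fun j => ?_⟩
  induction j using Fin.induction with
  | zero => rw [sum_Iic_zero _ rfl, Fin.cases_zero]
  | succ j ih =>
    rw [sum_Iic_succ _ (i := j.castSucc) rfl, ← ih, Fin.cases_succ]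
    have := hs j.castSucc_lt_succ.le
    omega

/-- The increments of a rank profile are block sizes adding up to `n`. -/
theorem IsRankProfile.nonempty_equiv {n p : ℕ} {t h : Fin p → ℕ} (ht : IsRankProfile n t)
    (hth : ∀ j, t j = ∑ l ∈ Finset.Iic j, h l) : Nonempty ((Σ i, Fin (h i)) ≃ Fin n) := by
  refine ⟨Fintype.equivFinOfCardEq ?_⟩
  rw [Fintype.card_sigma]
  simp only [Fintype.card_fin]
  rcases p with _ | q
  · simpa using (ht.zero rfl).symm
  · rw [← ht.last (Fin.last q) (by simp), hth]
    congr 1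
    ext x
    simpa using Fin.le_last x

/-! ### Trivial vector bundles -/

/-- The trivial bundle of rank `r`: the total space is `X × 𝔸^r`. -/
def trivialBundle {X : Type} (S : FunSpace X) (r : ℕ) : VecBundle S r where
  Fiber _ := Fin r → ℂ
  space := (S.prodAffine (Fin r)).induced fun z => (z.1, z.2)
  locally_trivial x := by
    refine ⟨Set.univ, @isOpen_univ X S.toTopologicalSpace, trivial,
      fun _ => LinearEquiv.refl ℂ _, ?_⟩
    refine isIso_of_isMorphism (ψ := fun z => ⟨⟨z.1.1, z.2⟩, trivial⟩)
      (isMorphism_prodAffine (isMorphism_induced ?_) fun i z => ?_)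
      (isMorphism_induced (isMorphism_induced (isMorphism_prodAffine ?_ ?_)))
      (fun _ => rfl) (fun _ => rfl)
    · exact (isMorphism_fst S (Fin r)).comp
        ((isMorphism_induced_self _ _).comp (isMorphism_induced_self _ _))
    · exact ((isMorphism_induced_self _ _).comp (isMorphism_induced_self _ _)).2 _ z
        (regularAt_snd S i _)
    · exact (isMorphism_induced_self S (Subtype.val : Set.univ → X)).comp
        (isMorphism_fst (S.restrict Set.univ) (Fin r))
    · exact fun i z => regularAt_snd _ i z

section trivialBundle

variable {X : Type} (S : FunSpace X) (r : ℕ)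

theorem isMorphism_trivialBundle_proj : IsMorphism (trivialBundle S r).space S Sigma.fst :=
  (isMorphism_fst S (Fin r)).comp (isMorphism_induced_self _ _)

theorem regularAt_trivialBundle_coord (i : Fin r) (z : Σ x, (trivialBundle S r).Fiber x) :
    (trivialBundle S r).space.RegularAt (fun z => z.2 i) z :=
  (isMorphism_induced_self _ fun z : Σ x, (trivialBundle S r).Fiber x =>
    ((z.1, z.2) : X × (Fin r → ℂ))).2 _ z (regularAt_snd S i _)

theorem isMorphism_trivialBundle {Y : Type} {T : FunSpace Y} {f : Y → X} {g : Y → Fin r → ℂ}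
    (hf : IsMorphism T S f) (hg : ∀ i y, T.RegularAt (fun z => g z i) y) :
    IsMorphism T (trivialBundle S r).space (fun y => ⟨f y, g y⟩) :=
  isMorphism_induced (isMorphism_prodAffine hf hg)

theorem isMorphism_trivialBundle_section (w : Fin r → ℂ) :
    IsMorphism S (trivialBundle S r).space (fun x => ⟨x, w⟩) :=
  isMorphism_trivialBundle S r ⟨by let _ := S.toTopologicalSpace; exact continuous_id,
    fun _ _ h => h⟩ fun _ _ => S.regularAt_const _ _

theorem mem_closure_trivialBundle_over (s : Set X) (z : Σ x, (trivialBundle S r).Fiber x) :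
    z ∈ closure[(trivialBundle S r).space.toTopologicalSpace] ((trivialBundle S r).over s) ↔
      z.1 ∈ closure[S.toTopologicalSpace] s := by
  let _ := S.toTopologicalSpace
  let _ := (trivialBundle S r).space.toTopologicalSpace
  exact ⟨fun h => map_mem_closure (isMorphism_trivialBundle_proj S r).1 h fun _ hz => hz,
    fun h => map_mem_closure (isMorphism_trivialBundle_section S r z.2).1 h fun _ hx => hx⟩

theorem trivialBundle_over_subset_closure_iff (s t : Set X) :
    (trivialBundle S r).over t ⊆
        closure[(trivialBundle S r).space.toTopologicalSpace] ((trivialBundle S r).over s) ↔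
      t ⊆ closure[S.toTopologicalSpace] s :=
  ⟨fun h x hx => (mem_closure_trivialBundle_over S r s ⟨x, fun _ => 0⟩).1 (h hx),
    fun h z hz => (mem_closure_trivialBundle_over S r s z).2 (h hz)⟩

theorem trivialBundle_over_isomorphic {s : Set X} {d : ℕ}
    (h : Isomorphic (S.restrict s) (affine (Fin d))) :
    Isomorphic ((trivialBundle S r).space.restrict ((trivialBundle S r).over s))
      (affine (Fin (d + r))) := by
  obtain ⟨_, e, rfl, h1, h2⟩ := h
  refine Isomorphic.trans (T := affine (Fin d ⊕ Fin r)) ?_ (affine_isomorphic_of_card (by simp))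
  refine ⟨fun z => Sum.elim (e ⟨z.1.1, z.2⟩) z.1.2, isIso_of_isMorphism
    (ψ := fun a => ⟨⟨(e.symm fun i => a (.inl i)).1, fun i => a (.inr i)⟩,
      (e.symm fun i => a (.inl i)).2⟩) (isMorphism_affine ?_) (isMorphism_induced ?_) ?_ ?_⟩
  · rintro (i | i) z
    · have h3 : IsMorphism ((trivialBundle S r).space.restrict ((trivialBundle S r).over s))
          (S.restrict s) (fun z => ⟨z.1.1, z.2⟩) :=
        isMorphism_induced ((isMorphism_trivialBundle_proj S r).comp (isMorphism_induced_self _ _))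
      exact (h1.comp h3).2 _ z (regularAt_coord i _)
    · exact (isMorphism_induced_self _ _).2 _ z (regularAt_trivialBundle_coord S r i _)
  · refine isMorphism_trivialBundle S r ?_ fun i a => regularAt_coord _ a
    have h3 : IsMorphism (affine (Fin d ⊕ Fin r)) (affine (Fin d)) (fun a i => a (.inl i)) :=
      isMorphism_affine fun i a => regularAt_coord _ a
    exact (isMorphism_induced_self S _).comp (h2.comp h3)
  · rintro ⟨⟨x, w⟩, hx⟩
    exact Subtype.ext (Sigma.ext (congrArg Subtype.val (e.symm_apply_apply ⟨x, hx⟩)) HEq.rfl)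
  · intro a
    funext i
    rcases i with i | i
    · exact congrFun (e.apply_symm_apply _) i
    · rfl

/-- A cell decomposition of the base induces one of the total space of a trivial bundle. -/
theorem trivialBundle_isCellDecomposition {ι : Type} [Finite ι] {cell : ι → Set X} {dim : ι → ℕ}
    (h : IsCellDecomposition S cell dim) :
    IsCellDecomposition (trivialBundle S r).space (fun i => (trivialBundle S r).over (cell i))
      (fun i => dim i + r) where
  existsUnique_mem z := h.existsUnique_mem z.1
  isLocallyClosed i := by
    let _ := S.toTopologicalSpace
    let _ := (trivialBundle S r).space.toTopologicalSpace
    exact (h.isLocallyClosed i).preimage (isMorphism_trivialBundle_proj S r).1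
  isomorphic_affine i := trivialBundle_over_isomorphic S r (h.isomorphic_affine i)
  closure_subset i j := by
    rintro ⟨z, hz, hz'⟩
    have := h.closure_subset i j ⟨z.1, hz, (mem_closure_trivialBundle_over S r _ z).1 hz'⟩
    exact ⟨(trivialBundle_over_subset_closure_iff S r _ _).2 this.1,
      fun hne => Nat.add_lt_add_right (this.2 hne) r⟩

end trivialBundle

/-! ### Linear algebra -/

/-- A family of vectors in triangular form is linearly independent. -/
theorem linearIndependent_of_pivots {ι X : Type*} [LinearOrder ι] [Fintype ι] {v : ι → X → ℂ}
    (c : ι → X) (h1 : ∀ l, v l (c l) ≠ 0) (h2 : ∀ l l', l < l' → v l' (c l) = 0) :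
    LinearIndependent ℂ v := by
  rw [Fintype.linearIndependent_iff]
  intro g hg l
  induction l using WellFoundedLT.induction with
  | ind l ih =>
    have h3 := congrFun hg (c l)
    rw [Finset.sum_apply, Finset.sum_eq_single l] at h3
    · simpa [h1 l] using h3
    · intro l' _ hne
      rcases lt_or_gt_of_ne hne with hlt | hlt
      · simp [ih l' hlt]
      · simp [h2 l l' hlt]
    · simp

/-- A linear map preserving the dimension of a subspace is injective on it. -/
theorem eq_zero_of_finrank_map_eq {V W : Type*} [AddCommGroup V] [Module ℂ V] [AddCommGroup W]
    [Module ℂ W] [FiniteDimensional ℂ V] {P : Submodule ℂ V} {f : V →ₗ[ℂ] W}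
    (h : Module.finrank ℂ (P.map f) = Module.finrank ℂ P) {x : V} (hx : x ∈ P) (hfx : f x = 0) :
    x = 0 := by
  have hinj := (LinearMap.injective_iff_surjective_of_finrank_eq_finrank h.symm).2
    (f.submoduleMap_surjective P)
  have : (⟨x, hx⟩ : P) = 0 := hinj (Subtype.ext (by simpa using hfx))
  exact congrArg Subtype.val this

/-! ### Row spaces -/

section Gras

variable {n N : ℕ}

/-- The first `k` coordinates of a vector. -/
def trunc (N k : ℕ) : (Fin N → ℂ) →ₗ[ℂ] ({j : Fin N // j.val < k} → ℂ) :=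
  LinearMap.funLeft ℂ ℂ (Subtype.val : {j : Fin N // j.val < k} → Fin N)

theorem mem_schubertCell {I : MultiIndex n N} {W : Gras n N} :
    W ∈ schubertCell I ↔ ∀ k, Module.finrank ℂ (W.1.map (trunc N k)) = countBelow I.1 k :=
  Iff.rfl

theorem rowSpace_map_trunc (M : FullRank n N) (k : ℕ) :
    (rowSpace M).1.map (trunc N k) = Submodule.span ℂ (Set.range fun l => trunc N k (M.1 l)) := by
  rw [rowSpace, Submodule.map_span, ← Set.range_comp]
  rfl

theorem regularAt_entry (i : Fin n) (j : Fin N) (M : FullRank n N) :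
    (fullRankSpace n N).RegularAt (fun M => M.1 i j) M :=
  (isMorphism_induced_self (affine (Fin n × Fin N)) fun (M : FullRank n N) ij =>
    M.1 ij.1 ij.2).2 _ M (regularAt_coord (i, j) _)

theorem isMorphism_fullRank {X : Type} {S : FunSpace X} {φ : X → FullRank n N}
    (h : ∀ i j x, S.RegularAt (fun z => (φ z).1 i j) x) :
    IsMorphism S (fullRankSpace n N) φ :=
  isMorphism_induced (isMorphism_affine fun ij x => h ij.1 ij.2 x)

theorem mem_rowSpace_iff (M : FullRank n N) (w : Fin N → ℂ) :
    w ∈ (rowSpace M).1 ↔ ∃ x : Fin n → ℂ, Matrix.vecMul x M.1 = w := by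
  rw [rowSpace, Submodule.mem_span_range_iff_exists_fun]
  refine exists_congr fun x => ?_
  rw [Matrix.vecMul_eq_sum]
  rfl

theorem row_mul_mem_rowSpace (M : FullRank n N) (g : Matrix (Fin n) (Fin n) ℂ) (l : Fin n) :
    (g * M.1) l ∈ (rowSpace M).1 :=
  (mem_rowSpace_iff M _).2 ⟨g l, rfl⟩

theorem rowSpace_eq_of_eq_mul {M M' : FullRank n N} {g : Matrix (Fin n) (Fin n) ℂ}
    (h : M'.1 = g * M.1) : rowSpace M' = rowSpace M := by
  refine Subtype.ext (Submodule.eq_of_le_of_finrank_eq (Submodule.span_le.2 ?_)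
    ((rowSpace M').2.trans (rowSpace M).2.symm))
  rintro _ ⟨l, rfl⟩
  have := row_mul_mem_rowSpace M g l
  rwa [← h] at this

theorem exists_eq_mul_of_rowSpace_eq {M M' : FullRank n N} (h : rowSpace M' = rowSpace M) :
    ∃ g : Matrix (Fin n) (Fin n) ℂ, M'.1 = g * M.1 := by
  have : ∀ l, ∃ x : Fin n → ℂ, Matrix.vecMul x M.1 = M'.1 l := fun l => by
    rw [← mem_rowSpace_iff, ← h]
    exact Submodule.subset_span ⟨l, rfl⟩
  choose g hg using this
  exact ⟨Matrix.of g, funext fun l => (hg l).symm⟩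

theorem rowSpace_surjective : Function.Surjective (rowSpace (n := n) (N := N)) := by
  rintro ⟨W, hW⟩
  let b := Module.finBasisOfFinrankEq ℂ W hW
  have hspan : Submodule.span ℂ (Set.range fun l => (b l : Fin N → ℂ)) = W := by
    have := congrArg (Submodule.map W.subtype) b.span_eq
    rwa [Submodule.map_span, ← Set.range_comp, Submodule.map_top, Submodule.range_subtype] at this
  have hr : (Matrix.of fun l => (b l : Fin N → ℂ)).rank = n := by
    rw [Matrix.rank_eq_finrank_span_row]
    exact (congrArg (fun V : Submodule ℂ (Fin N → ℂ) => Module.finrank ℂ V) hspan).trans hW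
  exact ⟨⟨_, hr⟩, Subtype.ext hspan⟩

theorem linearIndependent_rows (M : FullRank n N) : LinearIndependent ℂ M.1.row := by
  rw [linearIndependent_iff_card_eq_finrank_span, Fintype.card_fin, Set.finrank,
    ← Matrix.rank_eq_finrank_span_row, M.2]

theorem isOpen_le_finrank_trunc (k d : ℕ) : IsOpen[(grasSpace n N).toTopologicalSpace]
    {W : Gras n N | d ≤ Module.finrank ℂ (W.1.map (trunc N k))} := by
  have := (fullRankSpace n N).isOpen_le_finrank_span (fun M l => trunc N k (M.1 l))
    (fun l c M => regularAt_entry l c.1 M) d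
  change IsOpen[(fullRankSpace n N).toTopologicalSpace]
    {M : FullRank n N | d ≤ Module.finrank ℂ ((rowSpace M).1.map (trunc N k))}
  convert this using 3
  rw [rowSpace_map_trunc]

/-! ### Schubert cells -/

/-- On a Schubert cell a subspace is determined by its coordinates in the multi-index, and this
compatibly with truncation. -/
theorem eq_zero_of_mem_schubertCell {I : MultiIndex n N} {W : Gras n N} (hW : W ∈ schubertCell I)
    {w : Fin N → ℂ} (hw : w ∈ W.1) (k : ℕ) (h : ∀ i ∈ I.1, i.val < k → w i = 0) :
    ∀ j : Fin N, j.val < k → w j = 0 := by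
  induction k with
  | zero => exact fun j hj => absurd hj (Nat.not_lt_zero _)
  | succ k ih =>
    have ih' := ih fun i hi hik => h i hi (hik.trans (Nat.lt_succ_self k))
    intro j hj
    rcases Nat.lt_succ_iff_lt_or_eq.1 hj with hlt | heq
    · exact ih' j hlt
    by_cases hjI : j ∈ I.1
    · exact h j hjI hj
    -- no pivot at position `k`: forgetting the last coordinate does not decrease the dimension
    let r : ({j : Fin N // j.val < k + 1} → ℂ) →ₗ[ℂ] ({j : Fin N // j.val < k} → ℂ) :=
      LinearMap.funLeft ℂ ℂ fun j => ⟨j.1, j.2.trans (Nat.lt_succ_self k)⟩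
    have hr : r ∘ₗ trunc N (k + 1) = trunc N k := rfl
    have hcount : countBelow I.1 k = countBelow I.1 (k + 1) := by
      rw [countBelow, countBelow]
      congr 1
      refine Finset.filter_congr fun i hi => ?_
      have : i.val ≠ k := fun hik => hjI (by rwa [show j = i from Fin.ext (heq.trans hik.symm)])
      omega
    have hdim : Module.finrank ℂ ((W.1.map (trunc N (k + 1))).map r) =
        Module.finrank ℂ (W.1.map (trunc N (k + 1))) := by
      rw [← Submodule.map_comp, hr, mem_schubertCell.1 hW, mem_schubertCell.1 hW, hcount]
    have h0 := eq_zero_of_finrank_map_eq hdim (Submodule.mem_map_of_mem hw)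
      (funext fun i => ih' i.1 i.2)
    exact congrFun h0 ⟨j, hj⟩

/-- The columns of a matrix which belong to a multi-index. -/
def pivotBlock (I : MultiIndex n N) (M : Matrix (Fin n) (Fin N) ℂ) : Matrix (Fin n) (Fin n) ℂ :=
  M.submatrix id I.pos

theorem pivotBlock_mul (I : MultiIndex n N) (g : Matrix (Fin n) (Fin n) ℂ)
    (M : Matrix (Fin n) (Fin N) ℂ) : pivotBlock I (g * M) = g * pivotBlock I M := rfl

theorem exists_pos_eq {I : MultiIndex n N} {i : Fin N} (hi : i ∈ I.1) : ∃ l, I.pos l = i := by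
  have : i ∈ Set.range I.pos := by rw [MultiIndex.pos, Finset.range_orderEmbOfFin]; exact hi
  exact this

theorem pos_mem (I : MultiIndex n N) (l : Fin n) : I.pos l ∈ I.1 :=
  Finset.orderEmbOfFin_mem _ _ _

theorem det_pivotBlock_ne_zero {I : MultiIndex n N} {M : FullRank n N}
    (hM : rowSpace M ∈ schubertCell I) : (pivotBlock I M.1).det ≠ 0 := by
  intro hdet
  obtain ⟨x, hx0, hx⟩ := Matrix.exists_vecMul_eq_zero_iff.2 hdet
  have h1 : Matrix.vecMul x M.1 = 0 := by
    funext j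
    refine eq_zero_of_mem_schubertCell hM ((mem_rowSpace_iff M _).2 ⟨x, rfl⟩) N ?_ j j.2
    intro i hi _
    obtain ⟨l, rfl⟩ := exists_pos_eq hi
    exact congrFun hx l
  apply hx0
  have h2 := Fintype.linearIndependent_iff.1 (linearIndependent_rows M) x
  rw [Matrix.vecMul_eq_sum] at h1
  exact funext (h2 h1)

/-- Row `l` vanishes before column `I.pos l` and not in that column. -/
def HasPivots (I : MultiIndex n N) (M : Matrix (Fin n) (Fin N) ℂ) : Prop :=
  (∀ l j, j < I.pos l → M l j = 0) ∧ ∀ l, M l (I.pos l) ≠ 0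

theorem HasPivots.rank {I : MultiIndex n N} {M : Matrix (Fin n) (Fin N) ℂ} (h : HasPivots I M) :
    M.rank = n := by
  have hli : LinearIndependent ℂ M.row := linearIndependent_of_pivots I.pos h.2
    fun l l' hl => h.1 _ _ (I.pos.strictMono hl)
  rw [Matrix.rank_eq_finrank_span_row, finrank_span_eq_card hli, Fintype.card_fin]

theorem HasPivots.mem_schubertCell {I : MultiIndex n N} {M : FullRank n N}
    (h : HasPivots I M.1) : rowSpace M ∈ schubertCell I := by
  intro k
  change Module.finrank ℂ ((rowSpace M).1.map (trunc N k)) = countBelow I.1 k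
  let v : {l : Fin n // (I.pos l).val < k} → {j : Fin N // j.val < k} → ℂ :=
    fun l => trunc N k (M.1 l.1)
  have hspan : Submodule.span ℂ (Set.range fun l => trunc N k (M.1 l)) =
      Submodule.span ℂ (Set.range v) := by
    refine le_antisymm (Submodule.span_le.2 ?_) (Submodule.span_mono ?_)
    · rintro _ ⟨l, rfl⟩
      by_cases hl : (I.pos l).val < k
      · exact Submodule.subset_span ⟨⟨l, hl⟩, rfl⟩
      · have : trunc N k (M.1 l) = 0 := funext fun j =>
          h.1 l j.1 (Fin.lt_def.2 (j.2.trans_le (not_lt.1 hl)))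
        simp [this]
    · rintro _ ⟨l, rfl⟩
      exact ⟨l.1, rfl⟩
  have hli : LinearIndependent ℂ v := linearIndependent_of_pivots (fun l => ⟨I.pos l.1, l.2⟩)
    (fun l => h.2 l.1) fun l l' hl => h.1 _ _ (I.pos.strictMono hl)
  rw [rowSpace_map_trunc, hspan, finrank_span_eq_card hli, countBelow_eq_card I.2,
    Fintype.card_subtype]
  rfl

theorem finrank_trunc_of_le (W : Gras n N) {k : ℕ} (hk : N ≤ k) :
    Module.finrank ℂ (W.1.map (trunc N k)) = n := by
  have hinj : Function.Injective (trunc N k) := fun x y hxy =>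
    funext fun j => congrFun hxy ⟨j, j.2.trans_le hk⟩
  rw [← (Submodule.equivMapOfInjective _ hinj W.1).finrank_eq, W.2]

theorem isLocallyClosed_schubertCell (I : MultiIndex n N) :
    @IsLocallyClosed _ (grasSpace n N).toTopologicalSpace (schubertCell I) := by
  let _ := (grasSpace n N).toTopologicalSpace
  have h1 : IsOpen (⋂ k : Fin (N + 1),
      {W : Gras n N | countBelow I.1 k ≤ Module.finrank ℂ (W.1.map (trunc N k))}) :=
    isOpen_iInter_of_finite fun k => isOpen_le_finrank_trunc _ _
  have h2 : IsClosed (⋂ k : Fin (N + 1),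
      {W : Gras n N | Module.finrank ℂ (W.1.map (trunc N k)) ≤ countBelow I.1 k}) := by
    refine isClosed_iInter fun k => ⟨?_⟩
    have hc : {W : Gras n N | Module.finrank ℂ (W.1.map (trunc N k)) ≤ countBelow I.1 k}ᶜ =
        {W : Gras n N | countBelow I.1 k + 1 ≤ Module.finrank ℂ (W.1.map (trunc N k))} :=
      Set.ext fun W => by rw [Set.mem_compl_iff]; exact Nat.not_le
    rw [hc]
    exact isOpen_le_finrank_trunc _ _
  convert h1.isLocallyClosed.inter h2.isLocallyClosed using 1
  ext W
  simp only [mem_schubertCell, Set.mem_inter_iff, Set.mem_iInter, Set.mem_ofPred_eq]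
  refine ⟨fun h => ⟨fun k => (h k).ge, fun k => (h k).le⟩, fun h k => ?_⟩
  rcases lt_or_ge k (N + 1) with hk | hk
  · exact le_antisymm (h.2 ⟨k, hk⟩) (h.1 ⟨k, hk⟩)
  · rw [finrank_trunc_of_le W (by omega), countBelow_of_le _ (by omega), I.2]

/-- One more coordinate raises the dimension of the truncated subspace by at most one. -/
theorem finrank_trunc_succ (W : Gras n N) (k : ℕ) :
    Module.finrank ℂ (W.1.map (trunc N k)) ≤ Module.finrank ℂ (W.1.map (trunc N (k + 1))) ∧
      Module.finrank ℂ (W.1.map (trunc N (k + 1))) ≤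
        Module.finrank ℂ (W.1.map (trunc N k)) + 1 := by
  let r : ({j : Fin N // j.val < k + 1} → ℂ) →ₗ[ℂ] ({j : Fin N // j.val < k} → ℂ) :=
    LinearMap.funLeft ℂ ℂ fun j => ⟨j.1, j.2.trans (Nat.lt_succ_self k)⟩
  set P := W.1.map (trunc N (k + 1)) with hP
  have hr : W.1.map (trunc N k) = P.map r := by rw [hP, ← Submodule.map_comp]; rfl
  have h1 := (r.domRestrict P).finrank_range_add_finrank_ker
  rw [LinearMap.range_domRestrict, ← hr] at h1
  -- the kernel of forgetting a coordinate is determined by that coordinate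
  have h2 : Module.finrank ℂ (r.domRestrict P).ker ≤ 1 := by
    by_cases hk : k < N
    · let f : (r.domRestrict P).ker →ₗ[ℂ] ℂ :=
        LinearMap.proj (⟨⟨k, hk⟩, Nat.lt_succ_self k⟩ : {j : Fin N // j.val < k + 1}) ∘ₗ
          P.subtype ∘ₗ Submodule.subtype _
      have hf : Function.Injective f := by
        rw [injective_iff_map_eq_zero]
        rintro ⟨⟨x, hx⟩, hx0⟩ hfx
        refine Subtype.ext (Subtype.ext (funext fun j => ?_))
        rcases Nat.lt_succ_iff_lt_or_eq.1 j.2 with hlt | heq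
        · exact congrFun (LinearMap.mem_ker.1 hx0) ⟨j.1, hlt⟩
        · have : j = ⟨⟨k, hk⟩, Nat.lt_succ_self k⟩ := Subtype.ext (Fin.ext heq)
          rw [this]
          exact hfx
      simpa using LinearMap.finrank_le_finrank_of_injective hf
    · have hbot : (r.domRestrict P).ker = ⊥ := by
        rw [LinearMap.ker_eq_bot, injective_iff_map_eq_zero]
        rintro ⟨x, hx⟩ hx0
        exact Subtype.ext (funext fun j => congrFun hx0 ⟨j.1, by omega⟩)
      rw [hbot, finrank_bot]
      exact Nat.zero_le _
  omega

theorem existsUnique_schubertCell (W : Gras n N) : ∃! I : MultiIndex n N, W ∈ schubertCell I := by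
  classical
  let d : ℕ → ℕ := fun k => Module.finrank ℂ (W.1.map (trunc N k))
  let S : Finset (Fin N) := Finset.univ.filter fun i => d i.val < d (i.val + 1)
  have hd0 : d 0 = 0 := by
    have := Submodule.finrank_le (W.1.map (trunc N 0))
    simpa [d] using this
  have hS : ∀ k, k ≤ N → countBelow S k = d k := by
    intro k hk
    induction k with
    | zero => simp [countBelow, hd0]
    | succ k ih =>
      have ih := ih (by omega)
      have hstep := finrank_trunc_succ W k
      change d k ≤ d (k + 1) ∧ d (k + 1) ≤ d k + 1 at hstep
      rw [countBelow] at ih ⊢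
      by_cases hlt : d k < d (k + 1)
      · have : S.filter (fun i => i.val < k + 1) =
            insert ⟨k, hk⟩ (S.filter fun i => i.val < k) := by
          ext i
          simp only [Finset.mem_filter, Finset.mem_insert, Fin.ext_iff, S, Finset.mem_univ,
            true_and, Nat.lt_succ_iff_lt_or_eq]
          constructor
          · rintro ⟨h, h' | h'⟩
            · exact Or.inr ⟨h, h'⟩
            · exact Or.inl h'
          · rintro (h | h)
            · exact ⟨by rw [h]; exact hlt, Or.inr h⟩
            · exact ⟨h.1, Or.inl h.2⟩
        rw [this, Finset.card_insert_of_notMem (by simp), ih]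
        omega
      · have : S.filter (fun i => i.val < k + 1) = S.filter fun i => i.val < k := by
          refine Finset.filter_congr fun i hi => ?_
          have h1 : d i.val < d (i.val + 1) := (Finset.mem_filter.1 hi).2
          have : i.val ≠ k := fun h => hlt (h ▸ h1)
          omega
        rw [this, ih]
        omega
  have hdN : ∀ k, N ≤ k → d k = n := fun k hk => finrank_trunc_of_le W hk
  have hcard : S.card = n := by rw [← countBelow_of_le S le_rfl, hS N le_rfl, hdN N le_rfl]
  have hmem : W ∈ schubertCell (⟨S, hcard⟩ : MultiIndex n N) := by
    refine mem_schubertCell.2 fun k => ?_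
    rcases le_total k N with hk | hk
    · exact (hS k hk).symm
    · rw [countBelow_of_le _ hk]
      exact (hdN k hk).trans hcard.symm
  refine ⟨_, hmem, fun J hJ => ?_⟩
  have h : ∀ k, countBelow J.1 k = countBelow S k := fun k =>
    (mem_schubertCell.1 hJ k).symm.trans (mem_schubertCell.1 hmem k)
  exact MultiIndex.eq_of_le_of_le (fun k => (h k).le) fun k => (h k).ge

/-! ### Coordinates and closures of Schubert cells -/

/-- The free entries of the reduced echelon matrices with pivots in the columns of `I`. -/
abbrev FreeEntry (I : MultiIndex n N) : Type :=
  {lj : Fin n × Fin N // lj.2 ∉ I.1 ∧ I.pos lj.1 < lj.2}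

theorem card_freeEntry (I : MultiIndex n N) : Fintype.card (FreeEntry I) = schubertDim I := by
  rw [Fintype.card_subtype, schubertDim]
  refine Finset.card_bij (fun lj _ => (I.pos lj.1, lj.2)) ?_ ?_ ?_
  · rintro ⟨l, j⟩ h
    simpa [pos_mem] using h
  · rintro ⟨l, j⟩ _ ⟨l', j'⟩ _ h
    simpa using h
  · rintro ⟨i, j⟩ h
    simp only [Finset.mem_filter, Finset.mem_univ, true_and] at h
    obtain ⟨l, rfl⟩ := exists_pos_eq h.1
    exact ⟨(l, j), by simpa using h.2, rfl⟩

open Classical in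
/-- The reduced echelon matrix with given free entries. -/
def echelon (I : MultiIndex n N) (a : FreeEntry I → ℂ) : Matrix (Fin n) (Fin N) ℂ :=
  Matrix.of fun l j => if j = I.pos l then 1 else
    if h : j ∉ I.1 ∧ I.pos l < j then a ⟨(l, j), h⟩ else 0

theorem pivotBlock_echelon (I : MultiIndex n N) (a : FreeEntry I → ℂ) :
    pivotBlock I (echelon I a) = 1 := by
  ext l l'
  simp [pivotBlock, echelon, Matrix.one_apply, pos_mem, eq_comm]

theorem hasPivots_echelon (I : MultiIndex n N) (a : FreeEntry I → ℂ) :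
    HasPivots I (echelon I a) := by
  refine ⟨fun l j hj => ?_, fun l => ?_⟩
  · simp [echelon, hj.ne, hj.not_gt]
  · simp [echelon]

/-- The reduced echelon matrix as a matrix of full rank. -/
def echelonPoint (I : MultiIndex n N) (a : FreeEntry I → ℂ) : FullRank n N :=
  ⟨echelon I a, (hasPivots_echelon I a).rank⟩

theorem echelonPoint_mem (I : MultiIndex n N) (a : FreeEntry I → ℂ) :
    rowSpace (echelonPoint I a) ∈ schubertCell I :=
  HasPivots.mem_schubertCell (M := echelonPoint I a) (hasPivots_echelon I a)

/-- A subspace in a Schubert cell is the row space of its reduced echelon matrix. -/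
theorem inv_pivotBlock_mul_eq_echelon {I : MultiIndex n N} {M : FullRank n N}
    (hM : rowSpace M ∈ schubertCell I) :
    (pivotBlock I M.1)⁻¹ * M.1 =
      echelon I fun lj => ((pivotBlock I M.1)⁻¹ * M.1) lj.1.1 lj.1.2 := by
  classical
  set M' := (pivotBlock I M.1)⁻¹ * M.1 with hM'
  have hblock : pivotBlock I M' = 1 := by
    rw [hM', pivotBlock_mul]
    exact Matrix.nonsing_inv_mul _ (det_pivotBlock_ne_zero hM).isUnit
  have hpos : ∀ l l', M' l (I.pos l') = if l = l' then 1 else 0 := fun l l' => by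
    rw [← Matrix.one_apply, ← hblock]; rfl
  ext l j
  rw [echelon, Matrix.of_apply]
  by_cases hj : j ∈ I.1
  · obtain ⟨l', rfl⟩ := exists_pos_eq hj
    simp [hpos, pos_mem, eq_comm]
  · have hne : j ≠ I.pos l := fun h => hj (h ▸ pos_mem I l)
    rw [if_neg hne]
    split_ifs with h
    · rfl
    · have hlt : j < I.pos l := lt_of_le_of_ne (not_lt.1 fun h' => h ⟨hj, h'⟩) hne
      refine eq_zero_of_mem_schubertCell hM (row_mul_mem_rowSpace M _ l) (I.pos l).val ?_ j hlt
      intro i hi hil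
      obtain ⟨l', rfl⟩ := exists_pos_eq hi
      change M' l (I.pos l') = 0
      rw [hpos, if_neg]
      rintro rfl
      exact lt_irrefl _ hil

/-- The normalized matrix of a subspace with respect to the columns in `I`, computed from a chosen
matrix with this row space. It is independent of the choice, and meaningful, only where the block
of these columns is invertible (`normalized_rowSpace`). -/
def normalized (I : MultiIndex n N) (W : Gras n N) : Matrix (Fin n) (Fin N) ℂ :=
  (pivotBlock I (Function.surjInv rowSpace_surjective W).1)⁻¹ *
    (Function.surjInv rowSpace_surjective W).1

theorem det_pivotBlock_ne_zero_of_rowSpace_eq {I : MultiIndex n N} {M M' : FullRank n N}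
    (h : rowSpace M' = rowSpace M) (hM : (pivotBlock I M.1).det ≠ 0) :
    (pivotBlock I M'.1).det ≠ 0 := by
  obtain ⟨g, hg⟩ := exists_eq_mul_of_rowSpace_eq h.symm
  rw [hg, pivotBlock_mul, Matrix.det_mul] at hM
  exact right_ne_zero_of_mul hM

theorem normalized_rowSpace {I : MultiIndex n N} {M : FullRank n N}
    (hM : (pivotBlock I M.1).det ≠ 0) :
    normalized I (rowSpace M) = (pivotBlock I M.1)⁻¹ * M.1 := by
  rw [normalized]
  have h := Function.surjInv_eq rowSpace_surjective (rowSpace M)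
  set M' := Function.surjInv rowSpace_surjective (rowSpace M)
  have hM' := det_pivotBlock_ne_zero_of_rowSpace_eq h hM
  obtain ⟨g, hg⟩ := exists_eq_mul_of_rowSpace_eq h
  rw [hg, pivotBlock_mul, Matrix.det_mul] at hM'
  rw [hg, pivotBlock_mul, Matrix.mul_inv_rev, Matrix.mul_assoc, ← Matrix.mul_assoc g⁻¹,
    Matrix.nonsing_inv_mul _ (left_ne_zero_of_mul hM').isUnit, Matrix.one_mul]

theorem schubertCell_isomorphic (I : MultiIndex n N) :
    Isomorphic ((grasSpace n N).restrict (schubertCell I)) (affine (FreeEntry I)) := by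
  let V : Set (Gras n N) := {W | ∃ M, rowSpace M = W ∧ (pivotBlock I M.1).det ≠ 0}
  have hV : rowSpace ⁻¹' V = {M | (pivotBlock I M.1).det ≠ 0} := by
    ext M
    exact ⟨fun ⟨M', h, h'⟩ => det_pivotBlock_ne_zero_of_rowSpace_eq h.symm h',
      fun h => ⟨M, rfl, h⟩⟩
  have hreg : ∀ M, (fullRankSpace n N).MatRegularAt (fun M => pivotBlock I M.1) M :=
    fun M i j => regularAt_entry _ _ _
  have hVopen : IsOpen[(fullRankSpace n N).toTopologicalSpace] (rowSpace ⁻¹' V) := by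
    rw [hV]
    exact isOpen_ne_zero _ fun M => (hreg M).det
  refine isomorphic_affine_of_slice (sl := echelonPoint I)
    (isMorphism_fullRank fun i j a => ?_) (echelonPoint_mem I)
    (fun W lj => normalized I W lj.1.1 lj.1.2) V hVopen ?_ ?_ ?_ ?_
  · simp only [echelonPoint, echelon, Matrix.of_apply]
    split_ifs
    · exact regularAt_const _ _ _
    · exact regularAt_coord _ a
    · exact regularAt_const _ _ _
  · intro W hW
    obtain ⟨M, rfl⟩ := rowSpace_surjective W
    exact ⟨M, rfl, det_pivotBlock_ne_zero hW⟩
  · intro lj M hM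
    refine regularAt_congr _ _ _ M _ hVopen hM (fun M' hM' => ?_)
      (((hreg M).inv (hV.subset hM)).mul (fun i j => regularAt_entry i j M) lj.1.1 lj.1.2)
    rw [normalized_rowSpace (hV.subset hM')]
  · intro a
    funext lj
    have hblock : pivotBlock I (echelonPoint I a).1 = 1 := pivotBlock_echelon I a
    rw [normalized_rowSpace (by simp [hblock]), hblock, inv_one, Matrix.one_mul]
    have hne : lj.1.2 ≠ I.pos lj.1.1 := lj.2.2.ne'
    simp only [echelonPoint, echelon, Matrix.of_apply, if_neg hne, dif_pos lj.2]
  · intro W hW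
    obtain ⟨M, rfl⟩ := rowSpace_surjective W
    rw [normalized_rowSpace (det_pivotBlock_ne_zero hW)]
    exact rowSpace_eq_of_eq_mul (inv_pivotBlock_mul_eq_echelon hW).symm

theorem le_of_mem_closure_schubertCell {I J : MultiIndex n N} {W : Gras n N}
    (hJ : W ∈ schubertCell J)
    (hI : W ∈ closure[(grasSpace n N).toTopologicalSpace] (schubertCell I)) : J.Le I := by
  let _ := (grasSpace n N).toTopologicalSpace
  intro k
  by_contra! hlt
  obtain ⟨W', h1, h2⟩ := mem_closure_iff.1 hI _ (isOpen_le_finrank_trunc k (countBelow I.1 k + 1))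
    (hlt.trans_eq (mem_schubertCell.1 hJ k).symm)
  have h3 := mem_schubertCell.1 h2 k
  have h4 : countBelow I.1 k + 1 ≤ _ := h1
  omega

theorem schubertCell_subset_closure {I J : MultiIndex n N} (h : J.Le I) :
    schubertCell J ⊆ closure[(grasSpace n N).toTopologicalSpace] (schubertCell I) := by
  classical
  intro W hW
  obtain ⟨M, rfl⟩ := rowSpace_surjective W
  have hle := (J.le_iff_pos I).1 h
  have hM := inv_pivotBlock_mul_eq_echelon hW
  set a : FreeEntry J → ℂ := fun lj => ((pivotBlock J M.1)⁻¹ * M.1) lj.1.1 lj.1.2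
  have hJ := hasPivots_echelon J a
  -- move the pivot of each row forward by adding `t` in the new pivot column
  let D : Matrix (Fin n) (Fin N) ℂ :=
    Matrix.of fun l j => if j = I.pos l ∧ I.pos l ≠ J.pos l then 1 else 0
  have hzero : ∀ (t : ℂ) l j, j < I.pos l → (echelon J a + t • D) l j = 0 := by
    intro t l j hj
    simp [D, hj.ne, hJ.1 l j (hj.trans_le (hle l))]
  have hpiv : ∀ t : ℂ, t ≠ 0 → HasPivots I (echelon J a + t • D) := by
    refine fun t ht => ⟨hzero t, fun l => ?_⟩
    by_cases heq : I.pos l = J.pos l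
    · have := hJ.2 l
      simpa [D, heq] using this
    · simpa [D, heq, hJ.1 l _ (lt_of_le_of_ne (hle l) heq)] using ht
  have hrank : ∀ t : ℂ, (echelon J a + t • D).rank = n := by
    intro t
    by_cases ht : t = 0
    · simpa [ht] using hJ.rank
    · exact (hpiv t ht).rank
  let φ : (Unit → ℂ) → FullRank n N := fun t => ⟨_, hrank (t ())⟩
  have hφ : IsMorphism (affine Unit) (fullRankSpace n N) φ := by
    refine isMorphism_fullRank fun i j t => ?_
    simp only [φ, Matrix.add_apply, Matrix.smul_apply, smul_eq_mul]
    exact regularAt_add _ _ _ _ (regularAt_const _ _ _)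
      (regularAt_mul _ _ _ _ (regularAt_coord () t) (regularAt_const _ _ _))
  have h0 : rowSpace (φ 0) = rowSpace M := by
    refine rowSpace_eq_of_eq_mul (g := (pivotBlock J M.1)⁻¹) ?_
    rw [hM]
    simp [φ]
  rw [← h0]
  refine mem_closure_of_curve ((isMorphism_quotient_self _ rowSpace).comp hφ) fun t ht => ?_
  refine HasPivots.mem_schubertCell (M := φ t) (hpiv _ fun h => ht (funext fun _ => h))

/-- The Schubert cells form a cell decomposition of the Grassmannian. -/
theorem isCellDecomposition_schubertCell :
    IsCellDecomposition (grasSpace n N) (schubertCell (n := n) (N := N)) schubertDim :=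
  isCellDecomposition_of_le MultiIndex.Le existsUnique_schubertCell isLocallyClosed_schubertCell
    (fun I => (schubertCell_isomorphic I).trans (affine_isomorphic_of_card (card_freeEntry I)))
    (fun _ _ ⟨_, hJ, hI⟩ => le_of_mem_closure_schubertCell hJ hI)
    (fun _ _ h => schubertCell_subset_closure h)
    (fun _ _ h hne => MultiIndex.schubertDim_lt h hne)

end Gras

/-! ### The flag of observed subspaces -/

section LinSys

variable {m n p : ℕ}

/-- The row `l` of `C A ^ k`. -/
def LinSys.outRow (s : LinSys m n p) (l : Fin p) (k : ℕ) : Fin n → ℂ := (s.C * s.A ^ k) l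

theorem LinSys.outRow_succ (s : LinSys m n p) (l : Fin p) (k : ℕ) :
    s.outRow l (k + 1) = s.outRow l k ᵥ* s.A := by
  rw [LinSys.outRow, pow_succ, ← Matrix.mul_assoc]
  rfl

theorem LinSys.outRow_zero (s : LinSys m n p) (l : Fin p) : s.outRow l 0 = s.C l := by
  rw [LinSys.outRow, pow_zero, Matrix.mul_one]

/-- The space of linear functionals on the state space observed by the first `j` outputs. -/
def LinSys.observed (s : LinSys m n p) (j : ℕ) : Submodule ℂ (Fin n → ℂ) :=
  Submodule.span ℂ (Set.range fun lk : {l : Fin p // l.val < j} × ℕ => s.outRow lk.1 lk.2)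

theorem LinSys.outRow_mem_observed (s : LinSys m n p) {l : Fin p} {j : ℕ} (h : l.val < j) (k : ℕ) :
    s.outRow l k ∈ s.observed j :=
  Submodule.subset_span ⟨(⟨l, h⟩, k), rfl⟩

theorem LinSys.observed_le_iff (s : LinSys m n p) {j : ℕ} {P : Submodule ℂ (Fin n → ℂ)} :
    s.observed j ≤ P ↔ ∀ l : Fin p, l.val < j → ∀ k, s.outRow l k ∈ P := by
  rw [LinSys.observed, Submodule.span_le]
  exact ⟨fun h l hl k => h ⟨(⟨l, hl⟩, k), rfl⟩, by rintro h _ ⟨⟨l, k⟩, rfl⟩; exact h l.1 l.2 k⟩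

theorem LinSys.observed_mono (s : LinSys m n p) : Monotone s.observed := fun _ _ hjk =>
  s.observed_le_iff.2 fun _ hl k => s.outRow_mem_observed (hl.trans_le hjk) k

/-- The observed space is the smallest invariant subspace containing the first rows of `C`. -/
theorem LinSys.observed_le (s : LinSys m n p) {j : ℕ} {P : Submodule ℂ (Fin n → ℂ)}
    (h1 : ∀ l : Fin p, l.val < j → s.C l ∈ P) (h2 : ∀ x ∈ P, x ᵥ* s.A ∈ P) : s.observed j ≤ P := by
  refine s.observed_le_iff.2 fun l hl k => ?_
  induction k with
  | zero => rw [s.outRow_zero]; exact h1 l hl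
  | succ k ih => rw [s.outRow_succ]; exact h2 _ ih

theorem LinSys.vecMul_mem_observed (s : LinSys m n p) {j : ℕ} {x : Fin n → ℂ}
    (hx : x ∈ s.observed j) : x ᵥ* s.A ∈ s.observed j := by
  have : s.observed j ≤ (s.observed j).comap (Matrix.vecMulLinear s.A) := by
    refine s.observed_le_iff.2 fun l hl k => ?_
    have := s.outRow_mem_observed hl (k + 1)
    rwa [s.outRow_succ] at this
  exact this hx

theorem LinSys.Observable.observed_eq_top {s : LinSys m n p} (hs : s.Observable) {j : ℕ}
    (hj : p ≤ j) : s.observed j = ⊤ := by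
  apply Submodule.eq_top_of_finrank_eq
  refine le_antisymm (Submodule.finrank_le _) ?_
  rw [Module.finrank_fin_fun]
  conv_lhs => rw [← hs, Matrix.rank_eq_finrank_span_row]
  refine Submodule.finrank_mono (Submodule.span_le.2 ?_)
  rintro _ ⟨⟨k, l⟩, rfl⟩
  exact s.outRow_mem_observed (l.2.trans_le hj) k

theorem LinSys.Equiv.outRow_eq {s t : LinSys m n p} {g : GL (Fin n) ℂ}
    (hA : t.A = (g : Matrix (Fin n) (Fin n) ℂ) * s.A *
      ((g⁻¹ : GL (Fin n) ℂ) : Matrix (Fin n) (Fin n) ℂ))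
    (hC : t.C = s.C * ((g⁻¹ : GL (Fin n) ℂ) : Matrix (Fin n) (Fin n) ℂ)) (l : Fin p) (k : ℕ) :
    t.outRow l k = s.outRow l k ᵥ* ((g⁻¹ : GL (Fin n) ℂ) : Matrix (Fin n) (Fin n) ℂ) := by
  induction k with
  | zero => rw [s.outRow_zero, t.outRow_zero, hC]; rfl
  | succ k ih =>
    rw [s.outRow_succ, t.outRow_succ, ih, hA, Matrix.vecMul_vecMul, Matrix.vecMul_vecMul,
      ← Matrix.mul_assoc, ← Matrix.mul_assoc, Units.inv_mul, Matrix.one_mul]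

theorem LinSys.Equiv.finrank_observed_eq {s t : LinSys m n p} (h : s.Equiv t) (j : ℕ) :
    Module.finrank ℂ (s.observed j) = Module.finrank ℂ (t.observed j) := by
  have key : ∀ {s t : LinSys m n p}, s.Equiv t →
      Module.finrank ℂ (t.observed j) ≤ Module.finrank ℂ (s.observed j) := by
    rintro s t ⟨g, hA, -, hC⟩
    have : t.observed j ≤ (s.observed j).map (Matrix.vecMulLinear
        ((g⁻¹ : GL (Fin n) ℂ) : Matrix (Fin n) (Fin n) ℂ)) :=
      t.observed_le_iff.2 fun l hl k =>
        ⟨s.outRow l k, s.outRow_mem_observed hl k, (LinSys.Equiv.outRow_eq hA hC l k).symm⟩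
    exact (Submodule.finrank_mono this).trans (Submodule.finrank_map_le _ _)
  exact le_antisymm (key (LinSys.equiv_equivalence.symm h)) (key h)

/-- The dimensions of the spaces observed by the first `1, …, p` outputs. -/
def rankProfile (x : SysCo m n p) (j : Fin p) : ℕ :=
  Quotient.lift (s := obsSetoid m n p)
    (fun s : ObsSystems m n p => Module.finrank ℂ (s.1.observed (j.val + 1)))
    (fun _ _ h => LinSys.Equiv.finrank_observed_eq h _) x

theorem rankProfile_mk (s : ObsSystems m n p) (j : Fin p) :
    rankProfile (Quotient.mk (obsSetoid m n p) s) j =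
      Module.finrank ℂ (s.1.observed (j.val + 1)) := rfl

theorem isRankProfile_rankProfile (x : SysCo m n p) : IsRankProfile n (rankProfile x) := by
  induction x using Quotient.inductionOn with
  | h s =>
    refine ⟨fun i j hij => Submodule.finrank_mono (s.1.observed_mono ?_), fun j hj => ?_, ?_⟩
    · exact Nat.succ_le_succ (Fin.le_def.1 hij)
    · rw [rankProfile_mk, s.2.observed_eq_top hj.ge, finrank_top, Module.finrank_fin_fun]
    · rintro rfl
      have h1 := s.2
      have h2 := s.1.obsMatrix.rank_le_card_height
      rw [LinSys.Observable] at h1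
      simpa [h1] using h2

theorem regularAt_coords (i : (Fin n × Fin n) ⊕ (Fin n × Fin m) ⊕ (Fin p × Fin n))
    (s : ObsSystems m n p) : (obsSystemsSpace m n p).RegularAt (fun s => s.1.coords i) s :=
  (isMorphism_induced_self (affine ((Fin n × Fin n) ⊕ (Fin n × Fin m) ⊕ (Fin p × Fin n)))
    fun (s : ObsSystems m n p) => s.1.coords).2 _ s (regularAt_coord i _)

theorem matRegularAt_A (s : ObsSystems m n p) :
    (obsSystemsSpace m n p).MatRegularAt (fun s => s.1.A) s := fun i j =>
  regularAt_coords (.inl (i, j)) s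

theorem matRegularAt_B (s : ObsSystems m n p) :
    (obsSystemsSpace m n p).MatRegularAt (fun s => s.1.B) s := fun i j =>
  regularAt_coords (.inr (.inl (i, j))) s

theorem matRegularAt_C (s : ObsSystems m n p) :
    (obsSystemsSpace m n p).MatRegularAt (fun s => s.1.C) s := fun i j =>
  regularAt_coords (.inr (.inr (i, j))) s

theorem regularAt_outRow (l : Fin p) (k : ℕ) (c : Fin n) (s : ObsSystems m n p) :
    (obsSystemsSpace m n p).RegularAt (fun s => s.1.outRow l k c) s :=
  ((matRegularAt_C s).mul ((matRegularAt_A s).pow k)) l c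

theorem isMorphism_obsSystems {X : Type} {S : FunSpace X} {φ : X → ObsSystems m n p}
    (hA : ∀ x, S.MatRegularAt (fun z => (φ z).1.A) x)
    (hB : ∀ x, S.MatRegularAt (fun z => (φ z).1.B) x)
    (hC : ∀ x, S.MatRegularAt (fun z => (φ z).1.C) x) :
    IsMorphism S (obsSystemsSpace m n p) φ := by
  refine isMorphism_induced (isMorphism_affine ?_)
  rintro (ij | ij | ij) x
  · exact hA x ij.1 ij.2
  · exact hB x ij.1 ij.2
  · exact hC x ij.1 ij.2

theorem isOpen_le_rankProfile (j : Fin p) (d : ℕ) : IsOpen[(sysCoSpace m n p).toTopologicalSpace]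
    {x : SysCo m n p | d ≤ rankProfile x j} :=
  (obsSystemsSpace m n p).isOpen_le_finrank_span
    (fun s (lk : {l : Fin p // l.val < j.val + 1} × ℕ) => s.1.outRow lk.1 lk.2)
    (fun lk c s => regularAt_outRow lk.1.1 lk.2 c s) d

/-! ### The cells -/

/-- The systems with a given sequence of dimensions of observed spaces. -/
def profileCell (m : ℕ) {n p : ℕ} (t : Fin p → ℕ) : Set (SysCo m n p) := {x | rankProfile x = t}

theorem isLocallyClosed_profileCell (t : Fin p → ℕ) :
    @IsLocallyClosed _ (sysCoSpace m n p).toTopologicalSpace (profileCell m t) := by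
  let _ := (sysCoSpace m n p).toTopologicalSpace
  have h1 : IsOpen (⋂ j : Fin p, {x : SysCo m n p | t j ≤ rankProfile x j}) :=
    isOpen_iInter_of_finite fun j => isOpen_le_rankProfile _ _
  have h2 : IsClosed (⋂ j : Fin p, {x : SysCo m n p | rankProfile x j ≤ t j}) := by
    refine isClosed_iInter fun j => ⟨?_⟩
    have hc : {x : SysCo m n p | rankProfile x j ≤ t j}ᶜ =
        {x : SysCo m n p | t j + 1 ≤ rankProfile x j} :=
      Set.ext fun W => by rw [Set.mem_compl_iff]; exact Nat.not_le
    rw [hc]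
    exact isOpen_le_rankProfile _ _
  convert h1.isLocallyClosed.inter h2.isLocallyClosed using 1
  ext x
  simp only [profileCell, Set.mem_inter_iff, Set.mem_iInter, Set.mem_ofPred_eq]
  exact ⟨fun h => ⟨fun j => (congrFun h j).ge, fun j => (congrFun h j).le⟩,
    fun h => funext fun j => le_antisymm (h.2 j) (h.1 j)⟩

theorem le_of_mem_closure_profileCell {t : Fin p → ℕ} {x : SysCo m n p}
    (hx : x ∈ closure[(sysCoSpace m n p).toTopologicalSpace] (profileCell m t)) (j : Fin p) :
    rankProfile x j ≤ t j := by
  let _ := (sysCoSpace m n p).toTopologicalSpace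
  by_contra! hlt
  obtain ⟨y, h1, h2⟩ := mem_closure_iff.1 hx _ (isOpen_le_rankProfile j (t j + 1)) hlt
  have h3 := congrFun h2 j
  have h4 : t j + 1 ≤ rankProfile y j := h1
  omega

end LinSys

/-! ### Normal forms -/

section Chart

variable {m n p : ℕ} {h : Fin p → ℕ} (ε : (Σ i, Fin (h i)) ≃ Fin n)

/-- The output to which a state coordinate belongs. Throughout, `ε` labels the `n` state coordinates
by pairs of an output `l` and an exponent `k < h l`. -/
def blk (a : Fin n) : Fin p := (ε.symm a).1

/-- The position of a state coordinate among those belonging to the same output. -/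
def idx (a : Fin n) : ℕ := (ε.symm a).2.val

theorem idx_lt (a : Fin n) : idx ε a < h (blk ε a) := (ε.symm a).2.2

theorem blk_apply (x : Σ i, Fin (h i)) : blk ε (ε x) = x.1 := by
  rw [blk, Equiv.symm_apply_apply]

theorem idx_apply (x : Σ i, Fin (h i)) : idx ε (ε x) = x.2.val := by
  rw [idx, Equiv.symm_apply_apply]

/-- The rows `c_l A ^ k` with `k < h l`. -/
def obsBlock (s : LinSys m n p) : Matrix (Fin n) (Fin n) ℂ :=
  Matrix.of fun a => s.outRow (blk ε a) (idx ε a)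

theorem obsBlock_apply (s : LinSys m n p) (l : Fin p) {k : ℕ} (hk : k < h l) :
    obsBlock ε s (ε ⟨l, ⟨k, hk⟩⟩) = s.outRow l k := by
  change s.outRow (blk ε (ε ⟨l, ⟨k, hk⟩⟩)) (idx ε (ε ⟨l, ⟨k, hk⟩⟩)) = _
  rw [blk_apply, idx_apply]

/-- The rows `c_l A ^ k`, for `k ≤ h l`, of the system in normal form with parameters `u`: the
basis vector belonging to `(l, k)` if `k < h l`, and `u l` if `k = h l`. -/
def chartRow (u : Fin p → Fin n → ℂ) (l : Fin p) (k : ℕ) : Fin n → ℂ :=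
  if hk : k < h l then Pi.single (ε ⟨l, ⟨k, hk⟩⟩) 1 else u l

/-- The system in (Hermite) normal form with parameters `u` and `B`: the rows `c_l A ^ k` with
`k < h l` are the standard basis, and `c_l A ^ (h l) = u l`. -/
def chart (u : Fin p → Fin n → ℂ) (B : Matrix (Fin n) (Fin m) ℂ) : LinSys m n p where
  A := Matrix.of fun a => chartRow ε u (blk ε a) (idx ε a + 1)
  B := B
  C := Matrix.of fun l => chartRow ε u l 0

theorem chartRow_self (u : Fin p → Fin n → ℂ) (l : Fin p) : chartRow ε u l (h l) = u l := by
  simp [chartRow]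

theorem chartRow_blk (u : Fin p → Fin n → ℂ) (a : Fin n) :
    chartRow ε u (blk ε a) (idx ε a) = Pi.single a 1 := by
  rw [chartRow, dif_pos (idx_lt ε a)]
  congr 1
  exact ε.apply_symm_apply a

theorem outRow_chart (u : Fin p → Fin n → ℂ) (B : Matrix (Fin n) (Fin m) ℂ) (l : Fin p) {k : ℕ}
    (hk : k ≤ h l) : (chart ε u B).outRow l k = chartRow ε u l k := by
  induction k with
  | zero => rw [LinSys.outRow_zero]; rfl
  | succ k ih =>
    rw [LinSys.outRow_succ, ih (by omega), chartRow, dif_pos (show k < h l by omega),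
      Matrix.single_one_vecMul]
    change chartRow ε u (blk ε _) (idx ε _ + 1) = _
    rw [blk_apply, idx_apply]

theorem outRow_chart_blk (u : Fin p → Fin n → ℂ) (B : Matrix (Fin n) (Fin m) ℂ) (a : Fin n) :
    (chart ε u B).outRow (blk ε a) (idx ε a) = Pi.single a 1 := by
  rw [outRow_chart ε u B _ (idx_lt ε a).le, chartRow_blk]

theorem obsBlock_chart (u : Fin p → Fin n → ℂ) (B : Matrix (Fin n) (Fin m) ℂ) :
    obsBlock ε (chart ε u B) = 1 := by
  ext a b
  rw [obsBlock, Matrix.of_apply, outRow_chart_blk, Matrix.one_apply, Pi.single_apply]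
  simp [eq_comm]

theorem block_size_le (ε : (Σ i, Fin (h i)) ≃ Fin n) (l : Fin p) : h l ≤ n := by
  have := Fintype.card_le_of_injective (fun k : Fin (h l) => ε ⟨l, k⟩)
    fun k k' hk => by simpa using hk
  simpa using this

theorem observable_chart (u : Fin p → Fin n → ℂ) (B : Matrix (Fin n) (Fin m) ℂ) :
    (chart ε u B).Observable := by
  have htop : Submodule.span ℂ (Set.range (chart ε u B).obsMatrix.row) = ⊤ := by
    rw [eq_top_iff, ← (Pi.basisFun ℂ (Fin n)).span_eq]
    refine Submodule.span_mono ?_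
    rintro _ ⟨a, rfl⟩
    refine ⟨(⟨idx ε a, (idx_lt ε a).trans_le (block_size_le ε _)⟩, blk ε a), ?_⟩
    rw [Pi.basisFun_apply]
    exact outRow_chart_blk ε u B a
  rw [LinSys.Observable, Matrix.rank_eq_finrank_span_row, htop, finrank_top,
    Module.finrank_fin_fun]

/-- The normal form as a completely observable system. -/
def chartPoint (u : Fin p → Fin n → ℂ) (B : Matrix (Fin n) (Fin m) ℂ) : ObsSystems m n p :=
  ⟨chart ε u B, observable_chart ε u B⟩

theorem isMorphism_chartPoint {X : Type} {S : FunSpace X} {u : X → Fin p → Fin n → ℂ}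
    {B : X → Matrix (Fin n) (Fin m) ℂ} (hu : ∀ l a x, S.RegularAt (fun z => u z l a) x)
    (hB : ∀ x, S.MatRegularAt B x) :
    IsMorphism S (obsSystemsSpace m n p) (fun x => chartPoint ε (u x) (B x)) := by
  have hrow : ∀ l k a x, S.RegularAt (fun z => chartRow ε (u z) l k a) x := by
    intro l k a x
    simp only [chartRow]
    split_ifs
    · exact S.regularAt_const _ _
    · exact hu l a x
  exact isMorphism_obsSystems (fun x a b => hrow _ _ _ _) hB fun x a b => hrow _ _ _ _

/-- The vectors supported on the coordinates belonging to the first `j` outputs. -/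
def flag (j : ℕ) : Submodule ℂ (Fin n → ℂ) :=
  Submodule.span ℂ
    (Set.range fun a : {a : Fin n // (blk ε a).val < j} => (Pi.single a.1 1 : Fin n → ℂ))

theorem mem_flag {j : ℕ} {x : Fin n → ℂ} :
    x ∈ flag ε j ↔ ∀ a, j ≤ (blk ε a).val → x a = 0 := by
  constructor
  · intro hx a ha
    have : flag ε j ≤ (LinearMap.proj a : (Fin n → ℂ) →ₗ[ℂ] ℂ).ker := by
      refine Submodule.span_le.2 ?_
      rintro _ ⟨b, rfl⟩
      have : a ≠ b.1 := by rintro rfl; exact absurd b.2 (not_lt.2 ha)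
      simp [this]
    exact this hx
  · intro hx
    have : x = ∑ a, x a • (Pi.single a 1 : Fin n → ℂ) := by
      ext b; simp [Finset.sum_apply, Pi.single_apply]
    rw [this]
    refine Submodule.sum_mem _ fun a _ => ?_
    by_cases ha : (blk ε a).val < j
    · exact Submodule.smul_mem _ _ (Submodule.subset_span ⟨⟨a, ha⟩, rfl⟩)
    · rw [hx a (not_lt.1 ha), zero_smul]
      exact Submodule.zero_mem _

theorem flag_mono : Monotone (flag ε) := fun _ _ hij _ hx =>
  (mem_flag ε).2 fun a ha => (mem_flag ε).1 hx a (hij.trans ha)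

theorem card_blk_lt (l : Fin p) :
    Fintype.card {a : Fin n // (blk ε a).val < l.val + 1} = ∑ i ∈ Finset.Iic l, h i := by
  rw [Fintype.card_subtype, ← Finset.card_map ε.symm.toEmbedding]
  have : (Finset.univ.filter fun a : Fin n => (blk ε a).val < l.val + 1).map ε.symm.toEmbedding =
      (Finset.Iic l).sigma fun _ => Finset.univ := by
    ext ⟨i, k⟩
    rw [Finset.mem_map_equiv, Finset.mem_filter, Finset.mem_sigma, Finset.mem_Iic, Fin.le_def,
      Equiv.symm_symm, blk_apply]
    exact ⟨fun hi => ⟨Nat.lt_succ_iff.1 hi.2, Finset.mem_univ _⟩,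
      fun hi => ⟨Finset.mem_univ _, Nat.lt_succ_iff.2 hi.1⟩⟩
  rw [this, Finset.card_sigma]
  simp

theorem finrank_flag (l : Fin p) :
    Module.finrank ℂ (flag ε (l.val + 1)) = ∑ i ∈ Finset.Iic l, h i := by
  rw [flag, finrank_span_eq_card, card_blk_lt]
  have := (Pi.basisFun ℂ (Fin n)).linearIndependent.comp
    (Subtype.val : {a : Fin n // (blk ε a).val < l.val + 1} → Fin n) Subtype.val_injective
  convert this using 1
  ext a b
  simp

theorem chartRow_mem {u : Fin p → Fin n → ℂ} {P : Submodule ℂ (Fin n → ℂ)} {j : ℕ}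
    (hP : flag ε j ≤ P) (hu : ∀ l : Fin p, l.val < j → u l ∈ P) {l : Fin p} (hl : l.val < j)
    (k : ℕ) : chartRow ε u l k ∈ P := by
  rw [chartRow]
  split_ifs with hk
  · exact hP (Submodule.subset_span ⟨⟨_, by simpa [blk] using hl⟩, rfl⟩)
  · exact hu l hl

theorem vecMul_chart_mem {u : Fin p → Fin n → ℂ} {B : Matrix (Fin n) (Fin m) ℂ}
    {P : Submodule ℂ (Fin n → ℂ)} {j : ℕ} (hP : flag ε j ≤ P)
    (hu : ∀ l : Fin p, l.val < j → u l ∈ P) {x : Fin n → ℂ} (hx : x ∈ flag ε j) :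
    x ᵥ* (chart ε u B).A ∈ P := by
  rw [Matrix.vecMul_eq_sum]
  refine Submodule.sum_mem _ fun a _ => ?_
  by_cases ha : (blk ε a).val < j
  · exact Submodule.smul_mem _ _ (chartRow_mem ε hP hu ha _)
  · rw [(mem_flag ε).1 hx a (not_lt.1 ha), zero_smul]
    exact Submodule.zero_mem _

theorem flag_le_observed_chart (u : Fin p → Fin n → ℂ) (B : Matrix (Fin n) (Fin m) ℂ) (j : ℕ) :
    flag ε j ≤ (chart ε u B).observed j := by
  refine Submodule.span_le.2 ?_
  rintro _ ⟨a, rfl⟩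
  have := (chart ε u B).outRow_mem_observed a.2 (idx ε a.1)
  rwa [outRow_chart_blk] at this

theorem observed_chart {u : Fin p → Fin n → ℂ} (B : Matrix (Fin n) (Fin m) ℂ) {j : ℕ}
    (hu : ∀ l : Fin p, l.val < j → u l ∈ flag ε j) : (chart ε u B).observed j = flag ε j :=
  le_antisymm (LinSys.observed_le _ (fun _ hl => chartRow_mem ε le_rfl hu hl 0)
    fun _ hx => vecMul_chart_mem ε le_rfl hu hx) (flag_le_observed_chart ε u B j)

theorem rankProfile_chartPoint {u : Fin p → Fin n → ℂ} (B : Matrix (Fin n) (Fin m) ℂ)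
    (hu : ∀ l : Fin p, u l ∈ flag ε (l.val + 1)) (j : Fin p) :
    rankProfile (Quotient.mk (obsSetoid m n p) (chartPoint ε u B)) j =
      ∑ i ∈ Finset.Iic j, h i := by
  rw [rankProfile_mk, ← finrank_flag ε j, ← observed_chart ε B (u := u) fun l hl =>
    flag_mono ε (by omega) (hu l)]
  rfl

end Chart

/-! ### Existence of normal forms -/

/-- If adjoining to an invariant subspace `U` the orbit of a vector under an endomorphism raises
the dimension by `a`, then the first `a` vectors of the orbit suffice. -/
theorem orbit_mem_sup_span {V : Type*} [AddCommGroup V] [Module ℂ V] [FiniteDimensional ℂ V]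
    (T : V →ₗ[ℂ] V) (U : Submodule ℂ V) (hU : ∀ x ∈ U, T x ∈ U) (w : ℕ → V)
    (hw : ∀ k, w (k + 1) = T (w k)) {a : ℕ}
    (ha : Module.finrank ℂ (U ⊔ Submodule.span ℂ (Set.range w) : Submodule ℂ V) =
      Module.finrank ℂ U + a) (k : ℕ) :
    w k ∈ U ⊔ Submodule.span ℂ (w '' Set.Iio a) := by
  set W := U ⊔ Submodule.span ℂ (Set.range w) with hW
  let P : ℕ → Submodule ℂ V := fun k => U ⊔ Submodule.span ℂ (w '' Set.Iio k)
  have hPW : ∀ k, P k ≤ W := fun k =>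
    sup_le_sup le_rfl (Submodule.span_mono (Set.image_subset_range _ _))
  have hmono : ∀ k, P k ≤ P (k + 1) := fun k =>
    sup_le_sup le_rfl (Submodule.span_mono (Set.image_mono (Set.Iio_subset_Iio (Nat.le_succ k))))
  have hmem : ∀ {k l}, l < k → w l ∈ P k := fun {k l} hl =>
    Submodule.mem_sup_right (Submodule.subset_span ⟨l, hl, rfl⟩)
  -- once the increasing chain `P` stops to grow, it is constant
  have hstable : ∀ k, P (k + 1) = P k → ∀ l, w l ∈ P k := by
    intro k hk
    have hinv : P k ≤ (P k).comap T := by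
      refine sup_le (fun x hx => Submodule.mem_sup_left (hU x hx)) (Submodule.span_le.2 ?_)
      rintro _ ⟨l, hl, rfl⟩
      change T (w l) ∈ P k
      rw [← hw, ← hk]
      exact hmem (Nat.succ_lt_succ hl)
    intro l
    induction l with
    | zero => rw [← hk]; exact hmem (Nat.succ_pos k)
    | succ l ih => rw [hw]; exact hinv ih
  have hgrow : ∀ k, (∀ l, w l ∈ P k) ∨ Module.finrank ℂ U + k ≤ Module.finrank ℂ (P k) := by
    intro k
    induction k with
    | zero => exact Or.inr (Submodule.finrank_mono le_sup_left)
    | succ k ih =>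
      rcases ih with ih | ih
      · exact Or.inl fun l => hmono k (ih l)
      · by_cases heq : P (k + 1) = P k
        · exact Or.inl fun l => hmono k (hstable k heq l)
        · have := Submodule.finrank_lt_finrank_of_lt (lt_of_le_of_ne (hmono k) (Ne.symm heq))
          exact Or.inr (by omega)
  rcases hgrow a with h | h
  · exact h k
  · have : P a = W := Submodule.eq_of_le_of_finrank_le (hPW a) (by omega)
    change w k ∈ P a
    rw [this, hW]
    exact Submodule.mem_sup_right (Submodule.subset_span ⟨k, rfl⟩)

section Normal

variable {m n p : ℕ} {h : Fin p → ℕ} (ε : (Σ i, Fin (h i)) ≃ Fin n)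

/-- The span of the rows `c_l A ^ k` with `k < h l` and `l < j`. -/
def blockSpan (s : LinSys m n p) (j : ℕ) : Submodule ℂ (Fin n → ℂ) :=
  Submodule.span ℂ (Set.range fun a : {a : Fin n // (blk ε a).val < j} => obsBlock ε s a.1)

theorem outRow_mem_blockSpan (s : LinSys m n p) {j : ℕ} {l : Fin p} (hl : l.val < j) {k : ℕ}
    (hk : k < h l) : s.outRow l k ∈ blockSpan ε s j := by
  exact Submodule.subset_span ⟨⟨ε ⟨l, ⟨k, hk⟩⟩, by rwa [blk_apply]⟩, obsBlock_apply ε s l hk⟩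

theorem blockSpan_mono (s : LinSys m n p) : Monotone (blockSpan ε s) := fun _ _ hij =>
  Submodule.span_mono (by rintro _ ⟨a, rfl⟩; exact ⟨⟨a.1, a.2.trans_le hij⟩, rfl⟩)

/-- The block sizes `h` being the increments of the dimensions of the observed spaces, these are
spanned by the rows `c_l A ^ k` with `k < h l`. -/
theorem observed_le_blockSpan (s : LinSys m n p)
    (hs : ∀ j : Fin p, Module.finrank ℂ (s.observed (j.val + 1)) = ∑ i ∈ Finset.Iic j, h i)
    (j : ℕ) (hj : j ≤ p) : s.observed j ≤ blockSpan ε s j := by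
  induction j with
  | zero => exact s.observed_le_iff.2 fun l hl => absurd hl (Nat.not_lt_zero _)
  | succ j ih =>
    have ih := ih (by omega)
    let i : Fin p := ⟨j, hj⟩
    have hsup : s.observed (j + 1) =
        s.observed j ⊔ Submodule.span ℂ (Set.range (s.outRow i)) := by
      refine le_antisymm (s.observed_le_iff.2 fun l hl k => ?_)
        (sup_le (s.observed_mono (Nat.le_succ j)) (Submodule.span_le.2 ?_))
      · rcases Nat.lt_succ_iff_lt_or_eq.1 hl with hlt | heq
        · exact Submodule.mem_sup_left (s.outRow_mem_observed hlt k)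
        · obtain rfl : l = i := Fin.ext heq
          exact Submodule.mem_sup_right (Submodule.subset_span ⟨k, rfl⟩)
      · rintro _ ⟨k, rfl⟩
        exact s.outRow_mem_observed (Nat.lt_succ_self j) k
    have hdim : Module.finrank ℂ (s.observed (j + 1)) =
        Module.finrank ℂ (s.observed j) + h i := by
      rw [show s.observed (j + 1) = s.observed (i.val + 1) from rfl, hs i]
      rcases Nat.eq_zero_or_pos j with h0 | hpos
      · have h1 : s.observed j = ⊥ := le_bot_iff.1 (s.observed_le_iff.2 fun l hl => by omega)
        rw [h1, finrank_bot, sum_Iic_zero _ h0, zero_add]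
      · let i' : Fin p := ⟨j - 1, by omega⟩
        have h1 : s.observed j = s.observed (i'.val + 1) :=
          congrArg s.observed (Nat.sub_add_cancel hpos).symm
        rw [h1, hs i', sum_Iic_succ _ (i := i') (Nat.sub_add_cancel hpos).symm]
    have horb := orbit_mem_sup_span (Matrix.vecMulLinear s.A) (s.observed j)
      (fun x hx => s.vecMul_mem_observed hx) (s.outRow i) (s.outRow_succ i) (hsup ▸ hdim)
    have hle : s.observed j ⊔ Submodule.span ℂ (s.outRow i '' Set.Iio (h i)) ≤
        blockSpan ε s (j + 1) := by
      refine sup_le (ih.trans (blockSpan_mono ε s (Nat.le_succ j))) (Submodule.span_le.2 ?_)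
      rintro _ ⟨k, hk, rfl⟩
      exact outRow_mem_blockSpan ε s (Nat.lt_succ_self j) hk
    rw [hsup]
    refine sup_le (le_sup_left.trans hle) (Submodule.span_le.2 ?_)
    rintro _ ⟨k, rfl⟩
    exact hle (horb k)

theorem det_obsBlock_ne_zero {s : ObsSystems m n p}
    (hs : ∀ j : Fin p, Module.finrank ℂ (s.1.observed (j.val + 1)) = ∑ i ∈ Finset.Iic j, h i) :
    (obsBlock ε s.1).det ≠ 0 := by
  have htop : ⊤ ≤ Submodule.span ℂ (Set.range (obsBlock ε s.1).row) := by
    rw [← s.2.observed_eq_top le_rfl]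
    refine (observed_le_blockSpan ε s.1 hs p le_rfl).trans (Submodule.span_mono ?_)
    rintro _ ⟨a, rfl⟩
    exact ⟨a.1, rfl⟩
  have hli := linearIndependent_of_top_le_span_of_card_eq_finrank htop (by simp)
  exact ((Matrix.isUnit_iff_isUnit_det _).1
    (Matrix.linearIndependent_rows_iff_isUnit.1 hli)).ne_zero

/-- The rows `c_l A ^ (h l)` in the basis formed by the rows `c_l A ^ k` with `k < h l`. -/
def normU (s : LinSys m n p) (l : Fin p) : Fin n → ℂ := s.outRow l (h l) ᵥ* (obsBlock ε s)⁻¹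

theorem obsBlock_equiv {s t : LinSys m n p} {g : GL (Fin n) ℂ}
    (hA : t.A = (g : Matrix (Fin n) (Fin n) ℂ) * s.A *
      ((g⁻¹ : GL (Fin n) ℂ) : Matrix (Fin n) (Fin n) ℂ))
    (hC : t.C = s.C * ((g⁻¹ : GL (Fin n) ℂ) : Matrix (Fin n) (Fin n) ℂ)) :
    obsBlock ε t = obsBlock ε s * ((g⁻¹ : GL (Fin n) ℂ) : Matrix (Fin n) (Fin n) ℂ) :=
  funext fun _ => LinSys.Equiv.outRow_eq hA hC _ _

theorem det_obsBlock_equiv {s t : LinSys m n p} (hst : s.Equiv t)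
    (hs : (obsBlock ε s).det ≠ 0) : (obsBlock ε t).det ≠ 0 := by
  obtain ⟨g, hA, -, hC⟩ := hst
  rw [obsBlock_equiv ε hA hC, Matrix.det_mul]
  exact mul_ne_zero hs ((Matrix.isUnit_iff_isUnit_det _).1 (g⁻¹).isUnit).ne_zero

theorem inv_obsBlock_equiv {s t : LinSys m n p} {g : GL (Fin n) ℂ}
    (hA : t.A = (g : Matrix (Fin n) (Fin n) ℂ) * s.A *
      ((g⁻¹ : GL (Fin n) ℂ) : Matrix (Fin n) (Fin n) ℂ))
    (hC : t.C = s.C * ((g⁻¹ : GL (Fin n) ℂ) : Matrix (Fin n) (Fin n) ℂ)) :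
    (obsBlock ε t)⁻¹ = (g : Matrix (Fin n) (Fin n) ℂ) * (obsBlock ε s)⁻¹ := by
  rw [obsBlock_equiv ε hA hC, Matrix.mul_inv_rev, Matrix.coe_units_inv,
    Matrix.nonsing_inv_nonsing_inv _ ((Matrix.isUnit_iff_isUnit_det _).1 g.isUnit)]

theorem normU_equiv {s t : LinSys m n p} (hst : s.Equiv t) (l : Fin p) :
    normU ε s l = normU ε t l := by
  obtain ⟨g, hA, -, hC⟩ := hst
  rw [normU, normU, inv_obsBlock_equiv ε hA hC, LinSys.Equiv.outRow_eq hA hC,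
    Matrix.vecMul_vecMul, ← Matrix.mul_assoc, Units.inv_mul, Matrix.one_mul]

theorem obsBlock_mul_B_equiv {s t : LinSys m n p} (hst : s.Equiv t) :
    obsBlock ε s * s.B = obsBlock ε t * t.B := by
  obtain ⟨g, hA, hB, hC⟩ := hst
  rw [obsBlock_equiv ε hA hC, hB, Matrix.mul_assoc, ← Matrix.mul_assoc _ _ s.B, Units.inv_mul,
    Matrix.one_mul]

/-- A system for which the rows `c_l A ^ k`, `k < h l`, form a basis is equivalent to one in normal
form. -/
theorem equiv_chart {s : LinSys m n p} (hs : (obsBlock ε s).det ≠ 0) :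
    s.Equiv (chart ε (normU ε s) (obsBlock ε s * s.B)) := by
  have hu := hs.isUnit
  have hrow : ∀ l k, k ≤ h l → chartRow ε (normU ε s) l k ᵥ* obsBlock ε s = s.outRow l k := by
    intro l k hk
    rw [chartRow]
    split_ifs with hlt
    · rw [Matrix.single_one_vecMul]
      exact obsBlock_apply ε s l hlt
    · obtain rfl : k = h l := by omega
      rw [normU, Matrix.vecMul_vecMul, Matrix.nonsing_inv_mul _ hu, Matrix.vecMul_one]
  have hA : (chart ε (normU ε s) (obsBlock ε s * s.B)).A * obsBlock ε s = obsBlock ε s * s.A := by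
    funext a
    exact (hrow _ _ (idx_lt ε a)).trans (s.outRow_succ _ _)
  have hC : (chart ε (normU ε s) (obsBlock ε s * s.B)).C * obsBlock ε s = s.C := by
    funext l
    exact (hrow _ _ (Nat.zero_le _)).trans (s.outRow_zero _)
  refine ⟨Matrix.GeneralLinearGroup.mkOfDetNeZero _ hs, ?_, rfl, ?_⟩
  · rw [Matrix.coe_units_inv]
    change _ = obsBlock ε s * s.A * (obsBlock ε s)⁻¹
    rw [← hA, Matrix.mul_assoc, Matrix.mul_nonsing_inv _ hu, Matrix.mul_one]
  · rw [Matrix.coe_units_inv]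
    change _ = s.C * (obsBlock ε s)⁻¹
    rw [← hC, Matrix.mul_assoc, Matrix.mul_nonsing_inv _ hu, Matrix.mul_one]

theorem normU_mem_flag {s : ObsSystems m n p}
    (hs : ∀ j : Fin p, Module.finrank ℂ (s.1.observed (j.val + 1)) = ∑ i ∈ Finset.Iic j, h i)
    (l : Fin p) : normU ε s.1 l ∈ flag ε (l.val + 1) := by
  have hu := (det_obsBlock_ne_zero ε hs).isUnit
  have hle : blockSpan ε s.1 (l.val + 1) ≤
      (flag ε (l.val + 1)).comap (Matrix.vecMulLinear (obsBlock ε s.1)⁻¹) := by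
    refine Submodule.span_le.2 ?_
    rintro _ ⟨a, rfl⟩
    change obsBlock ε s.1 a.1 ᵥ* (obsBlock ε s.1)⁻¹ ∈ flag ε (l.val + 1)
    have : obsBlock ε s.1 a.1 ᵥ* (obsBlock ε s.1)⁻¹ = Pi.single a.1 1 := by
      change (obsBlock ε s.1 * (obsBlock ε s.1)⁻¹) a.1 = _
      rw [Matrix.mul_nonsing_inv _ hu]
      ext b
      simp [Matrix.one_apply, Pi.single_apply, eq_comm]
    rw [this]
    exact Submodule.subset_span ⟨a, rfl⟩
  exact hle (observed_le_blockSpan ε s.1 hs _ l.2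
    (s.1.outRow_mem_observed (Nat.lt_succ_self _) _))

/-- Every point of a cell has a representative in normal form. -/
theorem exists_chartPoint {x : SysCo m n p} (hx : ∀ j, rankProfile x j = ∑ i ∈ Finset.Iic j, h i) :
    ∃ (u : Fin p → Fin n → ℂ) (B : Matrix (Fin n) (Fin m) ℂ),
      (∀ l, u l ∈ flag ε (l.val + 1)) ∧
        x = Quotient.mk (obsSetoid m n p) (chartPoint ε u B) := by
  induction x using Quotient.inductionOn with
  | h s =>
    have hs : ∀ j : Fin p, Module.finrank ℂ (s.1.observed (j.val + 1)) =
        ∑ i ∈ Finset.Iic j, h i := fun j => hx j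
    exact ⟨_, _, normU_mem_flag ε hs, Quotient.sound (equiv_chart ε (det_obsBlock_ne_zero ε hs))⟩

/-! ### The cells are affine spaces -/

/-- The free parameters of the normal forms in a cell. -/
abbrev CellParam (m : ℕ) {n p : ℕ} {h : Fin p → ℕ} (ε : (Σ i, Fin (h i)) ≃ Fin n) : Type :=
  (Σ l : Fin p, {a : Fin n // (blk ε a).val < l.val + 1}) ⊕ (Fin n × Fin m)

theorem card_cellParam : Fintype.card (CellParam m ε) =
    ∑ l : Fin p, ∑ i ∈ Finset.Iic l, h i + n * m := by
  rw [Fintype.card_sum, Fintype.card_sigma, Fintype.card_prod, Fintype.card_fin, Fintype.card_fin]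
  simp only [card_blk_lt]

/-- The rows `u` of a normal form with given free parameters. -/
def cellU (y : CellParam m ε → ℂ) (l : Fin p) (a : Fin n) : ℂ :=
  if ha : (blk ε a).val < l.val + 1 then y (.inl ⟨l, ⟨a, ha⟩⟩) else 0

theorem cellU_mem_flag (y : CellParam m ε → ℂ) (l : Fin p) : cellU ε y l ∈ flag ε (l.val + 1) :=
  (mem_flag ε).2 fun _ ha => dif_neg (not_lt.2 ha)

/-- The matrix `B` of a normal form with given free parameters. -/
def cellB (y : CellParam m ε → ℂ) : Matrix (Fin n) (Fin m) ℂ :=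
  Matrix.of fun a b => y (.inr (a, b))

/-- The coordinates of an equivalence class of systems in the chart of normal forms. -/
def cellCoord (x : SysCo m n p) : CellParam m ε → ℂ :=
  Quotient.lift (s := obsSetoid m n p)
    (fun s : ObsSystems m n p => Sum.elim (fun la => normU ε s.1 la.1 la.2.1)
      fun ab => (obsBlock ε s.1 * s.1.B) ab.1 ab.2)
    (fun s t hst => by
      have h1 : ∀ l, normU ε s.1 l = normU ε t.1 l := normU_equiv ε hst
      have h2 : obsBlock ε s.1 * s.1.B = obsBlock ε t.1 * t.1.B := obsBlock_mul_B_equiv ε hst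
      simp only [h1, h2]) x

theorem cellCoord_mk (s : ObsSystems m n p) :
    cellCoord ε (Quotient.mk (obsSetoid m n p) s) =
      Sum.elim (fun la => normU ε s.1 la.1 la.2.1) fun ab => (obsBlock ε s.1 * s.1.B) ab.1 ab.2 :=
  rfl

theorem matRegularAt_obsBlock (s : ObsSystems m n p) :
    (obsSystemsSpace m n p).MatRegularAt (fun s => obsBlock ε s.1) s := fun _ c =>
  regularAt_outRow _ _ c s

theorem normU_chart (u : Fin p → Fin n → ℂ) (B : Matrix (Fin n) (Fin m) ℂ) (l : Fin p) :
    normU ε (chart ε u B) l = u l := by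
  rw [normU, obsBlock_chart, inv_one, Matrix.vecMul_one, outRow_chart ε u B l le_rfl,
    chartRow_self]

theorem cellCoord_chartPoint (u : Fin p → Fin n → ℂ) (B : Matrix (Fin n) (Fin m) ℂ) :
    cellCoord ε (Quotient.mk (obsSetoid m n p) (chartPoint ε u B)) =
      Sum.elim (fun la => u la.1 la.2.1) fun ab => B ab.1 ab.2 := by
  have h1 : ∀ l, normU ε (chartPoint ε u B).1 l = u l := normU_chart ε u B
  have h2 : obsBlock ε (chartPoint ε u B).1 * (chartPoint ε u B).1.B = B := by
    rw [show obsBlock ε (chartPoint ε u B).1 = 1 from obsBlock_chart ε u B, Matrix.one_mul]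
    rfl
  rw [cellCoord_mk, h2]
  simp only [h1]

theorem profileCell_isomorphic {t : Fin p → ℕ} (ht : ∀ j, t j = ∑ i ∈ Finset.Iic j, h i) :
    Isomorphic ((sysCoSpace m n p).restrict (profileCell m t)) (affine (CellParam m ε)) := by
  let V : Set (SysCo m n p) :=
    {x | ∃ s, Quotient.mk (obsSetoid m n p) s = x ∧ (obsBlock ε s.1).det ≠ 0}
  have hV : Quotient.mk (obsSetoid m n p) ⁻¹' V = {s | (obsBlock ε s.1).det ≠ 0} := by
    ext s
    exact ⟨fun ⟨s', h1, h2⟩ => det_obsBlock_equiv ε (Quotient.exact h1) h2, fun h => ⟨s, rfl, h⟩⟩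
  have hVopen : IsOpen[(obsSystemsSpace m n p).toTopologicalSpace]
      (Quotient.mk (obsSetoid m n p) ⁻¹' V) := by
    rw [hV]
    exact isOpen_ne_zero _ fun s => (matRegularAt_obsBlock ε s).det
  have hnf : ∀ x ∈ profileCell m t, ∃ (u : Fin p → Fin n → ℂ) (B : Matrix (Fin n) (Fin m) ℂ),
      (∀ l, u l ∈ flag ε (l.val + 1)) ∧
        x = Quotient.mk (obsSetoid m n p) (chartPoint ε u B) := fun x hx =>
    exists_chartPoint ε fun j => (congrFun hx j).trans (ht j)
  have hsl : IsMorphism (affine (CellParam m ε)) (obsSystemsSpace m n p)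
      (fun y => chartPoint ε (cellU ε y) (cellB ε y)) := by
    refine isMorphism_chartPoint ε (fun l a y => ?_) fun y a b =>
      regularAt_coord (σ := CellParam m ε) (.inr (a, b)) y
    simp only [cellU]
    split_ifs with ha
    · exact regularAt_coord (σ := CellParam m ε) (.inl ⟨l, ⟨a, ha⟩⟩) y
    · exact regularAt_const _ _ _
  refine isomorphic_affine_of_slice (sl := fun y => chartPoint ε (cellU ε y) (cellB ε y))
    hsl (fun y => ?_)
    (cellCoord ε) V hVopen (fun x hx => ?_) (fun i s hs => ?_) (fun y => ?_) fun x hx => ?_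
  · exact funext fun j =>
      (rankProfile_chartPoint ε _ (cellU_mem_flag ε y) j).trans (ht j).symm
  · obtain ⟨u, B, -, rfl⟩ := hnf x hx
    exact ⟨_, rfl, by simp [chartPoint, obsBlock_chart]⟩
  · have hdet : (obsBlock ε s.1).det ≠ 0 := hV.subset hs
    rcases i with la | ab
    · exact (MatRegularAt.mul
        (M := fun (s : ObsSystems m n p) (_ : Unit) => s.1.outRow la.1 (h la.1))
        (fun _ c => regularAt_outRow _ _ c s) ((matRegularAt_obsBlock ε s).inv hdet)) () la.2.1
    · exact ((matRegularAt_obsBlock ε s).mul (matRegularAt_B s)) ab.1 ab.2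
  · rw [cellCoord_chartPoint]
    funext i
    rcases i with ⟨l, a, ha⟩ | ⟨a, b⟩
    · exact dif_pos ha
    · rfl
  · obtain ⟨u, B, hu, rfl⟩ := hnf x hx
    simp only [cellCoord_chartPoint]
    congr 2
    funext l a
    rw [cellU]
    split_ifs with ha
    · rfl
    · exact ((mem_flag ε).1 (hu l) a (not_lt.1 ha)).symm

/-! ### Closures of the cells -/

/-- Each nonempty block contains an eigenvector of the state matrix modulo the flag of the earlier
blocks. -/
theorem exists_eigenvector (u : Fin p → Fin n → ℂ) (B : Matrix (Fin n) (Fin m) ℂ)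
    (hu : ∀ l, u l ∈ flag ε (l.val + 1)) (i : Fin p) (hi : 0 < h i) :
    ∃ (g : Fin n → ℂ) (μ : ℂ), g ∉ flag ε i.val ∧ (∀ a, blk ε a ≠ i → g a = 0) ∧
      g ᵥ* (chart ε u B).A - μ • g ∈ flag ε i.val := by
  classical
  set A := (chart ε u B).A with hA
  let Y : Type := {a : Fin n // blk ε a = i}
  let M : Matrix Y Y ℂ := A.submatrix Subtype.val Subtype.val
  have : Nonempty Y := ⟨⟨ε ⟨i, ⟨0, hi⟩⟩, blk_apply ε _⟩⟩
  obtain ⟨μ, hμ⟩ := Module.End.exists_eigenvalue (K := ℂ) (Matrix.vecMulLinear M)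
  obtain ⟨v, hv⟩ := hμ.exists_hasEigenvector
  have hvM : v ᵥ* M = μ • v := hv.apply_eq_smul
  let g : Fin n → ℂ := fun a => if ha : blk ε a = i then v ⟨a, ha⟩ else 0
  have hgY : ∀ a : Y, g a.1 = v a := fun a => dif_pos a.2
  have hg0 : ∀ a, blk ε a ≠ i → g a = 0 := fun a ha => dif_neg ha
  have hgflag : g ∈ flag ε (i.val + 1) := (mem_flag ε).2 fun a ha =>
    hg0 a fun h => by rw [h] at ha; omega
  refine ⟨g, μ, fun hg => ?_, hg0, (mem_flag ε).2 fun b hb => ?_⟩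
  · refine hv.2 (funext fun a => ?_)
    rw [← hgY a]
    exact (mem_flag ε).1 hg a.1 (by rw [a.2])
  · have hgA : g ᵥ* A ∈ flag ε (i.val + 1) := vecMul_chart_mem ε le_rfl
      (fun l hl => flag_mono ε (by omega) (hu l)) hgflag
    rcases Nat.eq_or_lt_of_le hb with heq | hlt
    · have hbi : blk ε b = i := Fin.ext heq.symm
      have h1 : (g ᵥ* A) b = (v ᵥ* M) ⟨b, hbi⟩ := by
        change ∑ a, g a * A a b = ∑ a : Y, v a * A a.1 b
        simp only [← hgY]
        rw [← Finset.sum_subtype (Finset.univ.filter fun a => blk ε a = i) (by simp)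
          fun a => g a * A a b]
        refine (Finset.sum_filter_of_ne fun a _ hne => ?_).symm
        by_contra hai
        exact hne (by rw [hg0 a hai, zero_mul])
      rw [Pi.sub_apply, h1, hvM, Pi.smul_apply, Pi.smul_apply, ← hgY, sub_self]
    · rw [Pi.sub_apply, Pi.smul_apply, (mem_flag ε).1 hgA b hlt, (mem_flag ε).1 hgflag b hlt,
        smul_zero, sub_zero]

/-- Moving the row `u i` of a normal form in the direction of an eigenvector of the next block
raises by one the dimension of the space observed by the outputs up to `i`, and no other of these
dimensions. -/
theorem rankProfile_perturb {u : Fin p → Fin n → ℂ} {B : Matrix (Fin n) (Fin m) ℂ}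
    (hu : ∀ l, u l ∈ flag ε (l.val + 1)) {i i' : Fin p} (hi : i'.val = i.val + 1)
    {g : Fin n → ℂ} {μ : ℂ} (hg : g ∉ flag ε i'.val) (hg0 : ∀ a, blk ε a ≠ i' → g a = 0)
    (hgA : g ᵥ* (chart ε u B).A - μ • g ∈ flag ε i'.val) {t : ℂ} (ht : t ≠ 0) (j : Fin p) :
    rankProfile (Quotient.mk (obsSetoid m n p)
        (chartPoint ε (fun l => u l + (if l = i then t else 0) • g) B)) j =
      ∑ l ∈ Finset.Iic j, h l + if j = i then 1 else 0 := by
  set u' : Fin p → Fin n → ℂ := fun l => u l + (if l = i then t else 0) • g with hu'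
  have hu'ne : ∀ l, l ≠ i → u' l = u l := fun l hl => by simp [hu', hl]
  have hu'i : u' i = u i + t • g := by simp [hu']
  have hgflag : g ∈ flag ε (i'.val + 1) := (mem_flag ε).2 fun a ha =>
    hg0 a fun h => by rw [h] at ha; omega
  rw [rankProfile_mk]
  change Module.finrank ℂ ((chart ε u' B).observed (j.val + 1)) = _
  by_cases hji : j = i
  · subst hji
    rw [if_pos rfl]
    rw [hi] at hg hgA
    -- the observed space is the flag extended by the eigenvector
    have hP : (chart ε u' B).observed (j.val + 1) =
        flag ε (j.val + 1) ⊔ Submodule.span ℂ {g} := by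
      have hgP : g ∈ flag ε (j.val + 1) ⊔ Submodule.span ℂ {g} :=
        Submodule.mem_sup_right (Submodule.mem_span_singleton_self g)
      have hu'P : ∀ l : Fin p, l.val < j.val + 1 →
          u' l ∈ flag ε (j.val + 1) ⊔ Submodule.span ℂ {g} := fun l hl =>
        Submodule.add_mem _ (Submodule.mem_sup_left (flag_mono ε (by omega) (hu l)))
          (Submodule.smul_mem _ _ hgP)
      refine le_antisymm (LinSys.observed_le _
        (fun l hl => chartRow_mem ε le_sup_left hu'P hl 0) ?_) (sup_le
          (flag_le_observed_chart ε u' B _) ?_)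
      · have hle : flag ε (j.val + 1) ⊔ Submodule.span ℂ {g} ≤
            (flag ε (j.val + 1) ⊔ Submodule.span ℂ {g}).comap
              (Matrix.vecMulLinear (chart ε u' B).A) := by
          refine sup_le (fun x hx => vecMul_chart_mem ε le_sup_left hu'P hx) ?_
          rw [Submodule.span_singleton_le_iff_mem]
          change g ᵥ* (chart ε u' B).A ∈ flag ε (j.val + 1) ⊔ Submodule.span ℂ {g}
          -- the rows of `A` in the block of `g` are not affected by the perturbation
          have hrow : g ᵥ* (chart ε u' B).A = g ᵥ* (chart ε u B).A := by
            rw [Matrix.vecMul_eq_sum, Matrix.vecMul_eq_sum]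
            refine Finset.sum_congr rfl fun a _ => ?_
            by_cases ha : blk ε a = i'
            · have hne : blk ε a ≠ j := fun h => by
                rw [← ha, h] at hi
                omega
              have : (chart ε u' B).A a = (chart ε u B).A a := by
                change chartRow ε u' (blk ε a) _ = chartRow ε u (blk ε a) _
                rw [chartRow, chartRow, hu'ne _ hne]
              rw [this]
            · rw [hg0 a ha, zero_smul, zero_smul]
          rw [hrow, ← sub_add_cancel (g ᵥ* (chart ε u B).A) (μ • g)]
          exact Submodule.add_mem _ (Submodule.mem_sup_left hgA) (Submodule.smul_mem _ _ hgP)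
        exact hle
      · rw [Submodule.span_singleton_le_iff_mem]
        have h1 := (chart ε u' B).outRow_mem_observed (Nat.lt_succ_self j.val) (h j)
        rw [outRow_chart ε u' B j le_rfl, chartRow_self, hu'i] at h1
        have h2 := flag_le_observed_chart ε u' B (j.val + 1) (hu j)
        have h3 := (Submodule.add_mem_iff_right _ h2).1 h1
        exact (Submodule.smul_mem_iff _ ht).1 h3
    rw [hP, Submodule.finrank_sup_span_singleton hg, finrank_flag]
  · rw [if_neg hji, add_zero, ← finrank_flag ε j]
    rw [observed_chart ε B fun l hl => ?_]
    by_cases hl' : l = i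
    · -- the block of `g` belongs to the flag
      subst hl'
      have hlj : i'.val + 1 ≤ j.val + 1 := by
        have : l.val ≠ j.val := fun h => hji (Fin.ext h.symm)
        omega
      rw [hu'i]
      exact Submodule.add_mem _ (flag_mono ε (by omega) (hu l))
        (Submodule.smul_mem _ _ (flag_mono ε hlj hgflag))
    · rw [hu'ne l hl']
      exact flag_mono ε (by omega) (hu l)

end Normal

section Closure

variable {m n p : ℕ}

/-- Raising a single entry of the rank profile by one, where this leaves it monotone, leads to a
cell whose closure contains the given point. -/
theorem mem_closure_profileCell_update (x : SysCo m n p) {i i' : Fin p}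
    (hi : i'.val = i.val + 1) (hlt : rankProfile x i < rankProfile x i') :
    x ∈ closure[(sysCoSpace m n p).toTopologicalSpace]
      (profileCell m (Function.update (rankProfile x) i (rankProfile x i + 1))) := by
  have hx := isRankProfile_rankProfile x
  obtain ⟨h, hh⟩ := exists_partialSums hx.monotone
  obtain ⟨ε⟩ := hx.nonempty_equiv hh
  obtain ⟨u, B, hu, hxu⟩ := exists_chartPoint ε hh
  have hpos : 0 < h i' := by
    have := sum_Iic_succ h hi
    rw [← hh, ← hh] at this
    omega
  obtain ⟨g, μ, hg, hg0, hgA⟩ := exists_eigenvector ε u B hu i' hpos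
  have hφ : IsMorphism (affine Unit) (obsSystemsSpace m n p)
      (fun t => chartPoint ε (fun l => u l + (if l = i then t () else 0) • g) B) := by
    refine isMorphism_chartPoint ε (fun l a t => ?_) fun _ => matRegularAt_const _ _
    simp only [Pi.add_apply, Pi.smul_apply, smul_eq_mul]
    refine regularAt_add _ _ _ _ (regularAt_const _ _ _)
      (regularAt_mul _ _ _ _ ?_ (regularAt_const _ _ _))
    split_ifs
    · exact regularAt_coord () t
    · exact regularAt_const _ _ _
  have h0 : x = Quotient.mk (obsSetoid m n p)
      (chartPoint ε (fun l => u l + (if l = i then (0 : Unit → ℂ) () else 0) • g) B) := by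
    simpa using hxu
  rw [h0]
  refine mem_closure_of_curve
    ((isMorphism_quotient_self _ (Quotient.mk (obsSetoid m n p))).comp hφ) fun t ht => ?_
  refine funext fun j => ?_
  refine (rankProfile_perturb ε hu hi hg hg0 hgA (fun h => ht (funext fun _ => h)) j).trans ?_
  rw [← hh, ← h0]
  by_cases hji : j = i
  · subst hji; simp
  · simp [hji]

theorem mem_closure_profileCell {t : Fin p → ℕ} (ht : IsRankProfile n t) (x : SysCo m n p)
    (hx : ∀ j, rankProfile x j ≤ t j) :
    x ∈ closure[(sysCoSpace m n p).toTopologicalSpace] (profileCell m t) := by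
  let _ := (sysCoSpace m n p).toTopologicalSpace
  induction hd : ∑ j, (t j - rankProfile x j) using Nat.strong_induction_on generalizing x with
  | _ d ih =>
    by_cases heq : ∀ j, rankProfile x j = t j
    · exact subset_closure (funext heq)
    -- raise the last entry of the profile which is too small
    push Not at heq
    obtain ⟨i, hi, hmax⟩ := (Finset.univ.filter fun j => rankProfile x j ≠ t j).exists_maximal
      (by obtain ⟨j, hj⟩ := heq; exact ⟨j, by simpa using hj⟩)
    have hprof := isRankProfile_rankProfile x
    have hine : rankProfile x i ≠ t i := (Finset.mem_filter.1 hi).2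
    have hip : i.val + 1 < p := by
      by_contra hcon
      have hl : i.val + 1 = p := by have := i.2; omega
      exact hine ((hprof.last i hl).trans (ht.last i hl).symm)
    let i' : Fin p := ⟨i.val + 1, hip⟩
    have hi' : rankProfile x i' = t i' := by
      by_contra hne
      have h1 : i' ≤ i := hmax (by simpa using hne) (Fin.le_def.2 (Nat.le_succ i.val))
      exact absurd (Fin.le_def.1 h1) (Nat.not_succ_le_self i.val)
    have hti : t i ≤ t i' := ht.monotone (Fin.le_def.2 (Nat.le_succ i.val))
    have hxi := hx i
    have hstep := mem_closure_profileCell_update x (i := i) (i' := i') rfl (by omega)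
    refine closure_minimal (fun y hy => ?_) isClosed_closure hstep
    have hy' : ∀ j, rankProfile y j =
        Function.update (rankProfile x) i (rankProfile x i + 1) j := congrFun hy
    have hyi : rankProfile y i = rankProfile x i + 1 := by rw [hy', Function.update_self]
    have hyj : ∀ j, j ≠ i → rankProfile y j = rankProfile x j := fun j hj => by
      rw [hy', Function.update_of_ne hj]
    refine ih _ ?_ y (fun j => ?_) rfl
    · rw [← hd]
      refine Finset.sum_lt_sum (fun j _ => ?_) ⟨i, Finset.mem_univ _, by omega⟩
      by_cases hj : j = i
      · subst hj; omega
      · rw [hyj j hj]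
    · by_cases hj : j = i
      · subst hj; omega
      · rw [hyj j hj]; exact hx j

end Closure

end ObsSys

end

theorem mainTheorem4 (m n p : ℕ) :
    ∃ (E : ObsSys.VecBundle (ObsSys.grasSpace n (p + n - 1)) (n * (m + 1)))
      (cell : ObsSys.MultiIndex n (p + n - 1) → Set (ObsSys.SysCo m n p)),
      -- the natural cell decomposition of the total space of `E`
      ObsSys.IsCellDecomposition E.space (fun I => E.over (ObsSys.schubertCell I))
        (fun I => ObsSys.schubertDim I + n * (m + 1)) ∧
      -- a cell decomposition of the moduli space with the same index set and cell dimensions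
      ObsSys.IsCellDecomposition (ObsSys.sysCoSpace m n p) cell
        (fun I => ObsSys.schubertDim I + n * (m + 1)) ∧
      -- and with the same closure relations
      ∀ I J : ObsSys.MultiIndex n (p + n - 1),
        cell J ⊆ closure[(ObsSys.sysCoSpace m n p).toTopologicalSpace] (cell I) ↔
          E.over (ObsSys.schubertCell J) ⊆
            closure[E.space.toTopologicalSpace] (E.over (ObsSys.schubertCell I)) := by
  obtain ⟨s, hs, hsurj, hle, hsum⟩ := ObsSys.exists_profile n p
  have hinj : ∀ I J, s I = s J → I = J := fun I J h =>
    ObsSys.MultiIndex.eq_of_le_of_le ((hle I J).2 fun j => (congrFun h j).le)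
      ((hle J I).2 fun j => (congrFun h j).ge)
  have hcl1 : ∀ I J, (ObsSys.profileCell m (s J) ∩
      closure[(ObsSys.sysCoSpace m n p).toTopologicalSpace]
        (ObsSys.profileCell m (s I))).Nonempty → ObsSys.MultiIndex.Le J I := by
    rintro I J ⟨x, hJ, hI⟩
    exact (hle J I).2 fun j =>
      (congrFun hJ j).symm.le.trans (ObsSys.le_of_mem_closure_profileCell hI j)
  have hcl2 : ∀ I J, ObsSys.MultiIndex.Le J I → ObsSys.profileCell m (s J) ⊆
      closure[(ObsSys.sysCoSpace m n p).toTopologicalSpace] (ObsSys.profileCell m (s I)) :=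
    fun I J h x hx => ObsSys.mem_closure_profileCell (hs I) x fun j =>
      (congrFun hx j).le.trans ((hle J I).1 h j)
  have hcell : ObsSys.IsCellDecomposition (ObsSys.sysCoSpace m n p)
      (fun I => ObsSys.profileCell m (s I)) (fun I => ObsSys.schubertDim I + n * (m + 1)) := by
    refine ObsSys.isCellDecomposition_of_le ObsSys.MultiIndex.Le (fun x => ?_)
      (fun I => ObsSys.isLocallyClosed_profileCell _) (fun I => ?_) hcl1 hcl2
      (fun I J h hne => Nat.add_lt_add_right (ObsSys.MultiIndex.schubertDim_lt h hne) _)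
    · obtain ⟨I, hI⟩ := hsurj _ (ObsSys.isRankProfile_rankProfile x)
      exact ⟨I, hI.symm, fun J hJ => hinj J I (Eq.trans (Eq.symm hJ) hI.symm)⟩
    · obtain ⟨h, hh⟩ := ObsSys.exists_partialSums (hs I).monotone
      obtain ⟨ε⟩ := (hs I).nonempty_equiv hh
      refine (ObsSys.profileCell_isomorphic ε hh).trans
        (ObsSys.FunSpace.affine_isomorphic_of_card ?_)
      rw [ObsSys.card_cellParam]
      simp only [← hh]
      rw [hsum, Nat.mul_add, Nat.mul_one]
      omega
  have hgras := ObsSys.isCellDecomposition_schubertCell (n := n) (N := p + n - 1)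
  refine ⟨ObsSys.trivialBundle _ _, fun I => ObsSys.profileCell m (s I),
    ObsSys.trivialBundle_isCellDecomposition _ _ hgras, hcell, fun I J => ?_⟩
  rw [ObsSys.trivialBundle_over_subset_closure_iff, hcell.subset_closure_iff hcl1 hcl2]
  exact (hgras.subset_closure_iff
    (fun _ _ ⟨_, hJ, hI⟩ => ObsSys.le_of_mem_closure_schubertCell hJ hI)
    (fun _ _ h => ObsSys.schubertCell_subset_closure h) I J).symm
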